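/- Let $N\in\mathbb N$, $\hbar>0$, and let $\hat x_n$ (multiplication by $x_n$) and $\hat p_n=-i\hbar\,\partial/\partial x_n$, $n=1,\dots,N$, act on the Schwartz space $\mathcal S(\mathbb R^N)$. Let $\hat H$ be a polynomial in the $\hat x_n,\hat p_n$ (the Hamiltonian), and let $\hat L_k$ ($k$ in a finite index set) be polynomials in the $\hat x_n,\hat p_n$ with complex coefficients that may depend on the time $t$ and on the current state. For $t$ in a time set $I\subseteq\mathbb R$ let $\hat\rho=\hat\rho(t)$ be an operator on $\mathcal S(\mathbb R^N)$ with integral kernel $\langle \mathbf x'|\hat\rho(t)|\mathbf x''\rangle\in\mathcal S(\mathbb R^{N}\times\mathbb R^N)$ (for instance a density matrix with such a kernel). Assume that the kernel is differentiable in $t$ in the topology of $\mathcal S(\mathbb R^N\times\mathbb R^N)$ and that $\hat\rho$ solves the master equation $$\frac{\partial\hat\rho}{\partial t}=\frac{i}{\hbar}[\hat\rho,\hat H]+\frac12\sum_k\Big([\hat L_k\hat\rho,\hat L_k^\dagger]+\text{h.c.}\Big),\qquad t\in I .$$ The Wigner function of $\hat\rho$ is $$W(\mathbf p,\mathbf x)=\frac1{(2\pi\hbar)^N}\int_{\mathbb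 R^N}\Big\langle \mathbf x+\tfrac{\boldsymbol\lambda}2\Big|\hat\rho\Big|\mathbf x-\tfrac{\boldsymbol\lambda}2\Big\rangle e^{-i\mathbf p\cdot\boldsymbol\lambda/\hbar}\,d^N\boldsymbol\lambda ,$$ and the Weyl symbol of a polynomial $\hat A$ in the $\hat x_n,\hat p_n$ is the polynomial $A_W(\mathbf p,\mathbf x)$ with $\langle\varphi,\hat A\psi\rangle=\int A_W\,W_{|\psi\rangle\langle\varphi|}\,d^N\mathbf p\,d^N\mathbf x$ for all $\varphi,\psi\in\mathcal S(\mathbb R^N)$, where $W_{|\psi\rangle\langle\varphi|}$ is the Wigner function of $|\psi\rangle\langle\varphi|$. Write $H_W,L_{W,k}$ for the Weyl symbols of $\hat H,\hat L_k$, let $^*$ be complex conjugation, and put $$\Lambda=\overleftarrow{\partial_{\mathbf x}}\cdot\overrightarrow{\partial_{\mathbf p}}-\overleftarrow{\partial_{\mathbf p}}\cdot\overrightarrow{\partial_{\mathbf x}},\qquad f\star g=f\,e^{\frac{i\hbar}2\Lambda}g=\sum_{l\ge0}\frac{(i\hbar/2)^l}{l!}f\Lambda^lg,\qquad f\circledast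 g=f\,\mathrm{sinc}\big(\tfrac\hbar2\Lambda\big)g=\sum_{l\ge0}\frac{(-1)^l(\hbar/2)^{2l}}{(2l+1)!}f\Lambda^{2l}g ,$$ where the arrows indicate which factor is differentiated and $\mathrm{sinc}\,y=\sin y/y$. Then for every $t\in I$ the Weyl symbols exist, all the series below have only finitely many nonzero terms, the fields $$J^W_{\mathbf p}=-W\circledast\frac{\partial H_W}{\partial\mathbf x}+\frac12\sum_k\Big(i\hbar\,(L_{W,k}\star W)\circledast\frac{\partial L_{W,k}^*}{\partial\mathbf x}+\text{c.c.}\Big),$$ $$J^W_{\mathbf x}=W\circledast\frac{\partial H_W}{\partial\mathbf p}-\frac12\sum_k\Big(i\hbar\,(L_{W,k}\star W)\circledast\frac{\partial L_{W,k}^*}{\partial\mathbf p}+\text{c.c.}\Big)$$ (c.c. is the complex conjugate of the whole preceding term, including the factor $i\hbar$) are smooth on phase space, and the Wigner function is differentiable in time and satisfies at every point $(\mathbf p,\mathbf x)$ the continuity equation $$\frac{\partial W}{\partial t}=-\nabla\cdot J^W=-\frac{\partial}{\partial\mathbf p}\cdot J^W_{\mathbf p}-\frac{\partial}{\partial\mathbf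 x}\cdot J^W_{\mathbf x}.$$ Time derivatives are taken within $I$. -/

import Mathlib

open scoped SchwartzMap ComplexConjugate LineDeriv ContDiff

noncomputable section

namespace WignerFlow

/-- Configuration space `ℝᴺ`. -/
abbrev Conf (N : ℕ) : Type := EuclideanSpace ℝ (Fin N)

/-- Phase space: a point is a pair `(p, x)`, momentum first and position second. -/
abbrev Phase (N : ℕ) : Type := Conf N × Conf N

/-- Linear operators on the Schwartz space `𝓢(ℝᴺ)`, the common invariant domain, dense in
`L²(ℝᴺ)`, of all polynomials in the positions and momenta.  Multiplication is composition. -/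
abbrev Op (N : ℕ) : Type := Module.End ℂ 𝓢(Conf N, ℂ)

variable {N : ℕ}

/-! ### Position and momentum operators -/

/-- The `n`-th unit vector of `ℝᴺ`. -/
def unitVec (n : Fin N) : Conf N := EuclideanSpace.single n 1

/-- The position operator `x̂ₙ`, multiplication by the coordinate `xₙ`. -/
def posOp (n : Fin N) : Op N :=
  (SchwartzMap.smulLeftCLM ℂ (fun x : Conf N => ((x n : ℝ) : ℂ))).toLinearMap

/-- The momentum operator `p̂ₙ = -iħ ∂/∂xₙ`. -/
def momOp (ħ : ℝ) (n : Fin N) : Op N :=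
  (-Complex.I * (ħ : ℂ)) • (LineDeriv.lineDerivOpCLM ℂ 𝓢(Conf N, ℂ) (unitVec n)).toLinearMap

theorem posOp_apply (n : Fin N) (ψ : 𝓢(Conf N, ℂ)) (x : Conf N) :
    posOp n ψ x = ((x n : ℝ) : ℂ) * ψ x := by
  have h : (fun x : Conf N => ((x n : ℝ) : ℂ)).HasTemperateGrowth :=
    ((Complex.ofRealCLM).comp (EuclideanSpace.proj n : Conf N →L[ℝ] ℝ)).hasTemperateGrowth
  simpa [posOp] using SchwartzMap.smulLeftCLM_apply_apply h ψ x

theorem momOp_apply (ħ : ℝ) (n : Fin N) (ψ : 𝓢(Conf N, ℂ)) (x : Conf N) :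
    momOp ħ n ψ x = -Complex.I * (ħ : ℂ) * fderiv ℝ ψ x (unitVec n) := by
  simp [momOp, SchwartzMap.lineDerivOp_apply_eq_fderiv]

/-- The operators that are polynomials, with complex coefficients, in the `x̂ₙ` and `p̂ₙ`. -/
def polyOps (ħ : ℝ) (N : ℕ) : Subalgebra ℂ (Op N) :=
  Algebra.adjoin ℂ (Set.range (posOp (N := N)) ∪ Set.range (momOp (N := N) ħ))

/-! ### Adjoints and kernels -/

/-- The `L²` scalar product `⟨φ, ψ⟩`, conjugate-linear in `φ`. -/
def braket (φ ψ : 𝓢(Conf N, ℂ)) : ℂ := ∫ x, conj (φ x) * ψ x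

/-- `B` is the (formal) adjoint of `A`: `⟨φ, A ψ⟩ = ⟨B φ, ψ⟩`.  Such a `B` is unique. -/
def IsAdjoint (A B : Op N) : Prop :=
  ∀ φ ψ : 𝓢(Conf N, ℂ), braket φ (A ψ) = braket (B φ) ψ

open Classical in
/-- The Hermitian conjugate `A†` (with value `0` if `A` has no adjoint preserving `𝓢(ℝᴺ)`). -/
def dagger (A : Op N) : Op N :=
  if h : ∃ B, IsAdjoint A B then h.choose else 0

/-- `A` is the integral operator with kernel `K (x', x'') = ⟨x'| A |x''⟩`. -/
def HasKernel (A : Op N) (K : Conf N × Conf N → ℂ) : Prop :=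
  ∀ (ψ : 𝓢(Conf N, ℂ)) (x : Conf N), A ψ x = ∫ y, K (x, y) * ψ y

/-! ### Wigner functions and Weyl symbols -/

/-- The Wigner function of a kernel,
`W (p, x) = (2πħ)⁻ᴺ ∫ ⟨x + l/2| ρ |x - l/2⟩ exp (-i p·l/ħ) dl`. -/
def wigner (ħ : ℝ) (K : Conf N × Conf N → ℂ) : Phase N → ℂ := fun z =>
  (((2 * Real.pi * ħ) ^ N : ℝ) : ℂ)⁻¹ *
    ∫ l : Conf N, K (z.2 + (1 / 2 : ℝ) • l, z.2 - (1 / 2 : ℝ) • l) *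
      Complex.exp (-Complex.I * ((inner ℝ z.1 l : ℝ) : ℂ) / (ħ : ℂ))

/-- The function on phase space given by a polynomial in the momenta (variables `Sum.inl n`) and
the positions (variables `Sum.inr n`). -/
def polyFun (a : MvPolynomial (Fin N ⊕ Fin N) ℂ) : Phase N → ℂ := fun z =>
  MvPolynomial.eval (Sum.elim (fun n => ((z.1 n : ℝ) : ℂ)) (fun n => ((z.2 n : ℝ) : ℂ))) a

/-- `a` is the Weyl symbol of `A`: all matrix elements of `A` are the phase-space averages of `a`
against the Wigner function of `|ψ⟩⟨φ|`. -/
def IsWeylSymbol (ħ : ℝ) (A : Op N) (a : Phase N → ℂ) : Prop :=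
  ∀ φ ψ : 𝓢(Conf N, ℂ),
    braket φ (A ψ) = ∫ z : Phase N, a z * wigner ħ (fun q => ψ q.1 * conj (φ q.2)) z

open Classical in
/-- The Weyl symbol of a polynomial in the `x̂ₙ` and `p̂ₙ`; it is a polynomial function on phase
space (value `0` for operators that have no polynomial symbol). -/
def weylSymbol (ħ : ℝ) (A : Op N) : Phase N → ℂ :=
  if h : ∃ a : MvPolynomial (Fin N ⊕ Fin N) ℂ, IsWeylSymbol ħ A (polyFun a) then
    polyFun h.choose else 0

/-! ### Moyal product and sinc product -/

/-- `∂f/∂pₙ`. -/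
def dP (n : Fin N) (f : Phase N → ℂ) : Phase N → ℂ := fun z => fderiv ℝ f z (unitVec n, 0)

/-- `∂f/∂xₙ`. -/
def dX (n : Fin N) (f : Phase N → ℂ) : Phase N → ℂ := fun z => fderiv ℝ f z (0, unitVec n)

/-- The bidifferential operator `∂ₓ(left)·∂ₚ(right) - ∂ₚ(left)·∂ₓ(right)`, acting on functions
`G z w` of two phase-space points, `z` being the left and `w` the right argument. -/
def biDiff (G : Phase N → Phase N → ℂ) : Phase N → Phase N → ℂ := fun z w =>
  ∑ n : Fin N, (dX n (fun z' => dP n (G z') w) z - dP n (fun z' => dX n (G z') w) z)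

/-- `f (∂ₓ(left)·∂ₚ(right) - ∂ₚ(left)·∂ₓ(right))ˡ g`. -/
def biDiffPow (l : ℕ) (f g : Phase N → ℂ) : Phase N → ℂ := fun z =>
  (biDiff^[l] (fun z' w' => f z' * g w')) z z

/-- The Moyal product: the exponential series in `(iħ/2) (∂ₓ·∂ₚ - ∂ₚ·∂ₓ)`. -/
def moyal (ħ : ℝ) (f g : Phase N → ℂ) : Phase N → ℂ := fun z =>
  ∑' l : ℕ, (Complex.I * (ħ : ℂ) / 2) ^ l / (l.factorial : ℂ) * biDiffPow l f g z

/-- The sinc product: the series of `sinc y = (sin y) / y = ∑ₗ (-1)ˡ y²ˡ / (2l+1)!` in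
`y = (ħ/2) (∂ₓ·∂ₚ - ∂ₚ·∂ₓ)`. -/
def sincProd (ħ : ℝ) (f g : Phase N → ℂ) : Phase N → ℂ := fun z =>
  ∑' l : ℕ, (-1 : ℂ) ^ l * ((ħ : ℂ) / 2) ^ (2 * l) / ((2 * l + 1).factorial : ℂ) *
    biDiffPow (2 * l) f g z

/-- The series defining `f ⋆ g` and the sinc product of `f` and `g` have finitely many nonzero
terms. -/
def SeriesTerminate (f g : Phase N → ℂ) : Prop :=
  ∃ M : ℕ, ∀ l, M ≤ l → ∀ z, biDiffPow l f g z = 0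

/-! ### Master equation and Wigner flow -/

/-- Right-hand side of the master equation,
`(i/ħ) [ρ, H] + ½ ∑ₖ ([Lₖ ρ, Lₖ†] + h.c.)`. -/
def lindblad {κ : Type*} [Fintype κ] (ħ : ℝ) (H : Op N) (L : κ → Op N) (ρ : Op N) : Op N :=
  (Complex.I / (ħ : ℂ)) • ⁅ρ, H⁆ +
    (1 / 2 : ℂ) • ∑ k, (⁅L k * ρ, dagger (L k)⁆ + dagger ⁅L k * ρ, dagger (L k)⁆)

/-- The operators `ρ t`, `t ∈ I`, with Schwartz kernels `K t`, solve the master equation on the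
time set `I`: the kernel is differentiable in time in the topology of the Schwartz space, and its
derivative is the kernel of the right-hand side.  The dissipators may depend on time and on the
current state. -/
def SolvesMasterEq {κ : Type*} [Fintype κ] (ħ : ℝ) (H : Op N) (L : κ → ℝ → Op N → Op N)
    (I : Set ℝ) (ρ : ℝ → Op N) (K : ℝ → 𝓢(Conf N × Conf N, ℂ)) : Prop :=
  ∀ t ∈ I, HasKernel (ρ t) (K t) ∧
    ∃ K' : 𝓢(Conf N × Conf N, ℂ), HasDerivWithinAt K K' I t ∧
      HasKernel (lindblad ħ H (fun k => L k t (ρ t)) (ρ t)) K'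

/-- Pointwise complex conjugate of a function on phase space. -/
def conjFun (f : Phase N → ℂ) : Phase N → ℂ := fun z => conj (f z)

/-- The component `J_{pₙ}` of the Wigner flow, for symbols `h` and `ℓₖ` and Wigner function `W`;
the complex conjugate is that of the whole term `iħ (ℓₖ ⋆ W) ⊛ ∂ℓₖ*/∂xₙ`. -/
def flowP {κ : Type*} [Fintype κ] (ħ : ℝ) (h : Phase N → ℂ) (ℓ : κ → Phase N → ℂ)
    (W : Phase N → ℂ) (n : Fin N) : Phase N → ℂ := fun z =>
  -sincProd ħ W (dX n h) z +
    (1 / 2 : ℂ) * ∑ k,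
      (Complex.I * (ħ : ℂ) * sincProd ħ (moyal ħ (ℓ k) W) (dX n (conjFun (ℓ k))) z +
        conj (Complex.I * (ħ : ℂ) * sincProd ħ (moyal ħ (ℓ k) W) (dX n (conjFun (ℓ k))) z))

/-- The component `J_{xₙ}` of the Wigner flow, for symbols `h` and `ℓₖ` and Wigner function `W`;
the complex conjugate is that of the whole term `iħ (ℓₖ ⋆ W) ⊛ ∂ℓₖ*/∂pₙ`. -/
def flowX {κ : Type*} [Fintype κ] (ħ : ℝ) (h : Phase N → ℂ) (ℓ : κ → Phase N → ℂ)
    (W : Phase N → ℂ) (n : Fin N) : Phase N → ℂ := fun z =>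
  sincProd ħ W (dP n h) z -
    (1 / 2 : ℂ) * ∑ k,
      (Complex.I * (ħ : ℂ) * sincProd ħ (moyal ħ (ℓ k) W) (dP n (conjFun (ℓ k))) z +
        conj (Complex.I * (ħ : ℂ) * sincProd ħ (moyal ħ (ℓ k) W) (dP n (conjFun (ℓ k))) z))

/-- Phase-space divergence `∂/∂p · Jp + ∂/∂x · Jx`. -/
def phaseDiv (Jp Jx : Fin N → Phase N → ℂ) : Phase N → ℂ := fun z =>
  ∑ n : Fin N, dP n (Jp n) z + ∑ n : Fin N, dX n (Jx n) z

/-- All objects entering the Wigner flow are well defined: `h`, `ℓₖ` are the Weyl symbols of `H`,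
`Lₖ`, the series of all Moyal and sinc products in the flow terminate, and the components of the
flow are smooth. -/
structure FlowWellDefined {κ : Type*} [Fintype κ] (ħ : ℝ) (H : Op N) (L : κ → Op N)
    (h : Phase N → ℂ) (ℓ : κ → Phase N → ℂ) (W : Phase N → ℂ) : Prop where
  symbol_H : IsWeylSymbol ħ H h
  symbol_L : ∀ k, IsWeylSymbol ħ (L k) (ℓ k)
  series_H : ∀ n, SeriesTerminate W (dX n h) ∧ SeriesTerminate W (dP n h)
  series_moyal : ∀ k, SeriesTerminate (ℓ k) W
  series_L : ∀ k n, SeriesTerminate (moyal ħ (ℓ k) W) (dX n (conjFun (ℓ k))) ∧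
    SeriesTerminate (moyal ħ (ℓ k) W) (dP n (conjFun (ℓ k)))
  smooth : ∀ n, ContDiff ℝ ∞ (flowP ħ h ℓ W n) ∧ ContDiff ℝ ∞ (flowX ħ h ℓ W n)

end WignerFlow

end

/-! ### Schwartz functions on products, formal adjoints and integral kernels. -/

noncomputable section

namespace WignerFlow

variable {N : ℕ}

open MeasureTheory

/-! ### Schwartz functions on product spaces -/

/-! The Wigner transform turns operator products into Moyal products: if `A` has Weyl symbol `a` and
`ρ` has Wigner function `W`, then `A ρ` and `ρ A` have Wigner functions `a ⋆ W` and `W ⋆ a`. For the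
generators `p̂ₙ`, `x̂ₙ` these are the Bopp shifts `wigner_genLeft` and `wigner_genRight`:
multiplication by the coordinate plus or minus `iħ/2` times its Hamiltonian vector field. The
general case follows by induction on the polynomial `a`, because Weyl quantization sends the product
with a coordinate to the symmetrized operator product (`Quantizes`), and the Moyal product obeys the
same recursion (`Smooth.starSum_onLeft_mulCoord`, `Smooth.starSum_onRight_mulCoord`). This gives
`Quantizes.smoothWigner_left` and `Quantizes.smoothWigner_right`.

A commutator `[ρ, A]` therefore has Wigner function `W ⋆ a - a ⋆ W`. Exchanging the factors changes
the sign of `Λ`, so this is `2i sin(ħΛ/2) = iħ sinc(ħΛ/2) Λ` applied to `W ⊗ a`. The remaining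
single `Λ`, followed by multiplication of the factors, is a phase-space divergence, since the mixed
second derivatives of the right factor cancel (`Smooth.merge_poisson`). As `Λ` has constant
coefficients, the result is `iħ` times the divergence of the field with position components `W ⊛
∂a/∂p` and momentum components `-(W ⊛ ∂a/∂x)` (`Smooth.starSum_sub_starSum_neg`).

Each dissipative term `[L ρ, L†]` is also a commutator, with `L ρ` in place of `ρ` and `L†` in place
of `A`: the corresponding functions are `ℓ ⋆ W` and the conjugate of `ℓ`. Hermitian conjugation of
an operator conjugates its Wigner function, which accounts for the c.c. terms. The time derivative
passes through because the Wigner transform at a point is continuous on Schwartz kernels.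

The iterated bidifferential operator is treated as the power of one endomorphism `Smooth.poisson` of
the tensor square of the algebra of smooth functions. There its commutators with coordinates and
derivatives are algebraic identities, and it is nilpotent as soon as one factor is a polynomial, so
that every series is a finite sum. -/

instance : (volume : Measure (Conf N × Conf N)).IsAddHaarMeasure :=
  inferInstanceAs ((volume : Measure (Conf N)).prod volume).IsAddHaarMeasure

section Product

variable {E F V : Type} [NormedAddCommGroup E] [NormedSpace ℝ E] [NormedAddCommGroup F]
  [NormedSpace ℝ F] [NormedAddCommGroup V] [NormedSpace ℝ V]

/-- The weight of order `k + m` in `(x, y)` dominates both `‖x‖ ^ k` and `(1 + ‖y‖) ^ m`. With `m`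
the integrable power this gives a majorant in `y` uniform in `x`. -/
theorem schwartz_decay_prod (G : 𝓢(E × F, V)) (k m : ℕ) :
    ∃ C : ℝ, 0 ≤ C ∧ ∀ x y, ‖x‖ ^ k * ‖G (x, y)‖ ≤ C * (1 + ‖y‖) ^ (-(m : ℝ)) := by
  have h := fun z => SchwartzMap.one_add_le_sup_seminorm_apply (𝕜 := ℝ) (m := (k + m, 0))
    (k := k + m) (n := 0) le_rfl le_rfl G z
  refine ⟨_, le_trans (by positivity) (h 0), fun x y => ?_⟩
  rw [Real.rpow_neg (by positivity), Real.rpow_natCast, ← div_eq_mul_inv,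
    le_div_iff₀ (by positivity)]
  refine le_trans ?_ (h (x, y))
  rw [norm_iteratedFDeriv_zero, pow_add]
  have h1 : ‖x‖ ≤ 1 + ‖(x, y)‖ := (norm_fst_le (x, y)).trans (by simp)
  have h2 : 1 + ‖y‖ ≤ 1 + ‖(x, y)‖ := by simp
  calc ‖x‖ ^ k * ‖G (x, y)‖ * (1 + ‖y‖) ^ m = ‖x‖ ^ k * (1 + ‖y‖) ^ m * ‖G (x, y)‖ := by ring
    _ ≤ _ := by gcongr

/-- The derivative of a Schwartz function on a product in the first factor. -/
def fderivFst (G : 𝓢(E × F, V)) : 𝓢(E × F, E →L[ℝ] V) :=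
  SchwartzMap.postcompCLM ((ContinuousLinearMap.compL ℝ E (E × F) V).flip
    (ContinuousLinearMap.inl ℝ E F)) (SchwartzMap.fderivCLM ℝ (E × F) V G)

theorem hasFDerivAt_section (G : 𝓢(E × F, V)) (x : E) (y : F) :
    HasFDerivAt (fun x => G (x, y)) (fderivFst G (x, y)) x :=
  (G.hasFDerivAt (x, y)).comp x (hasFDerivAt_prodMk_left x y)

theorem fderivFst_apply (G : 𝓢(E × F, V)) (z : E × F) (v : E) :
    fderivFst G z v = fderiv ℝ G z (v, 0) := rfl

variable [MeasurableSpace F] [BorelSpace F] [FiniteDimensional ℝ F] (μ : Measure F)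
  [μ.IsAddHaarMeasure]

theorem integrable_schwartz_section (G : 𝓢(E × F, V)) (x : E) :
    Integrable (fun y => G (x, y)) μ := by
  obtain ⟨C, -, hC⟩ := schwartz_decay_prod G 0 μ.integrablePower
  refine ((Measure.integrable_pow_neg_integrablePower μ).const_mul C).mono' ?_ ?_
  · exact (G.continuous.comp (by fun_prop)).aestronglyMeasurable
  · filter_upwards with y using by simpa using hC x y

theorem hasFDerivAt_integral_section (G : 𝓢(E × F, V)) (x : E) :
    HasFDerivAt (fun x => ∫ y, G (x, y) ∂μ) (∫ y, fderivFst G (x, y) ∂μ) x := by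
  obtain ⟨C, -, hC⟩ := schwartz_decay_prod (fderivFst G) 0 μ.integrablePower
  refine hasFDerivAt_integral_of_dominated_of_fderiv_le
    (F := fun x y => G (x, y)) (F' := fun x y => fderivFst G (x, y))
    (bound := fun y => C * (1 + ‖y‖) ^ (-(μ.integrablePower : ℝ))) Filter.univ_mem ?_
    (integrable_schwartz_section μ G x) (integrable_schwartz_section μ _ x).1 ?_
    ((Measure.integrable_pow_neg_integrablePower μ).const_mul C) ?_
  · filter_upwards with x using (integrable_schwartz_section μ G x).1
  · filter_upwards with y x _ using by simpa using hC x y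
  · filter_upwards with y x _ using hasFDerivAt_section G x y

/-- The derivative of a partial integral is the partial integral of `fderivFst G`, again Schwartz
but with values in `E →L[ℝ] V`. The target space is therefore generalized in the induction. -/
theorem contDiff_integral_section (n : ℕ) {V : Type} [NormedAddCommGroup V] [NormedSpace ℝ V]
    (G : 𝓢(E × F, V)) : ContDiff ℝ n (fun x => ∫ y, G (x, y) ∂μ) := by
  induction n generalizing V with
  | zero =>
    exact contDiff_zero.2 (continuous_iff_continuousAt.2 fun x =>
      (hasFDerivAt_integral_section μ G x).continuousAt)
  | succ n ih =>
    push_cast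
    refine contDiff_succ_iff_fderiv.2
      ⟨fun x => (hasFDerivAt_integral_section μ G x).differentiableAt, by simp, ?_⟩
    rw [show fderiv ℝ (fun x => ∫ y, G (x, y) ∂μ) = fun x => ∫ y, fderivFst G (x, y) ∂μ from
      funext fun x => (hasFDerivAt_integral_section μ G x).fderiv]
    exact ih _

theorem decay_integral_section (k n : ℕ) {V : Type} [NormedAddCommGroup V] [NormedSpace ℝ V]
    (G : 𝓢(E × F, V)) :
    ∃ C, ∀ x, ‖x‖ ^ k * ‖iteratedFDeriv ℝ n (fun x => ∫ y, G (x, y) ∂μ) x‖ ≤ C := by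
  induction n generalizing V with
  | zero =>
    obtain ⟨C, -, hC⟩ := schwartz_decay_prod G k μ.integrablePower
    refine ⟨∫ y, C * (1 + ‖y‖) ^ (-(μ.integrablePower : ℝ)) ∂μ, fun x => ?_⟩
    rw [norm_iteratedFDeriv_zero]
    refine (mul_le_mul_of_nonneg_left (norm_integral_le_integral_norm _) (by positivity)).trans ?_
    rw [← integral_const_mul]
    exact integral_mono ((integrable_schwartz_section μ G x).norm.const_mul _)
      ((Measure.integrable_pow_neg_integrablePower μ).const_mul C) fun y => hC x y
  | succ n ih =>
    obtain ⟨C, hC⟩ := ih (fderivFst G)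
    refine ⟨C, fun x => ?_⟩
    rw [← norm_iteratedFDeriv_fderiv,
      show fderiv ℝ (fun x => ∫ y, G (x, y) ∂μ) = fun x => ∫ y, fderivFst G (x, y) ∂μ from
        funext fun x => (hasFDerivAt_integral_section μ G x).fderiv]
    exact hC x

/-- Integration over the second factor, as a Schwartz function of the first. -/
def integralSnd (G : 𝓢(E × F, V)) : 𝓢(E, V) where
  toFun x := ∫ y, G (x, y) ∂μ
  smooth' := contDiff_infty.2 fun n => contDiff_integral_section μ n G
  decay' k n := decay_integral_section μ k n G

@[simp]
theorem integralSnd_apply (G : 𝓢(E × F, V)) (x : E) :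
    integralSnd μ G x = ∫ y, G (x, y) ∂μ := rfl

end Product

/-! ### Kernels -/

/-- Schwartz kernels. -/
abbrev Ker (N : ℕ) : Type := 𝓢(Conf N × Conf N, ℂ)

/-- The Schwartz function `x'' ↦ K (x', x'')`. -/
def rowCLM (x : Conf N) : Ker N →L[ℂ] 𝓢(Conf N, ℂ) :=
  SchwartzMap.compCLMOfAntilipschitz ℂ (K := 1) (g := fun y : Conf N => (x, y))
    (by
      have : (fun y : Conf N => (x, y)) = fun y => ContinuousLinearMap.inr ℝ _ _ y + (x, 0) := by
        ext y <;> simp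
      rw [this]
      exact (ContinuousLinearMap.hasTemperateGrowth _).add (.const _))
    (AntilipschitzWith.of_le_mul_dist fun y y' => by simp [Prod.dist_eq])

@[simp]
theorem rowCLM_apply (x : Conf N) (K : Ker N) (y : Conf N) : rowCLM x K y = K (x, y) := rfl

/-- The restriction of a kernel to the diagonal. -/
def diagCLM : Ker N →L[ℂ] 𝓢(Conf N, ℂ) :=
  SchwartzMap.compCLMOfAntilipschitz ℂ (K := 1) (g := fun y : Conf N => (y, y))
    ((ContinuousLinearMap.id ℝ (Conf N)).prod (ContinuousLinearMap.id ℝ (Conf N))).hasTemperateGrowth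
    (AntilipschitzWith.of_le_mul_dist fun y y' => by simp [Prod.dist_eq])

theorem schwartz_eq_zero_of_integral {E : Type} [NormedAddCommGroup E] [NormedSpace ℝ E]
    [MeasurableSpace E] [BorelSpace E] [FiniteDimensional ℝ E] {μ : Measure E}
    [μ.IsAddHaarMeasure] (u : 𝓢(E, ℂ)) (h : ∫ x, conj (u x) * u x ∂μ = 0) : u = 0 := by
  have h1 : ∀ x, conj (u x) * u x = ((‖u x‖ ^ 2 : ℝ) : ℂ) := fun x => by
    rw [Complex.conj_mul', Complex.ofReal_pow]
  simp_rw [h1] at h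
  rw [integral_complex_ofReal, Complex.ofReal_eq_zero] at h
  have hi : Integrable (fun x => ‖u x‖ ^ 2) μ := by
    simpa using (u.memLp 2 μ).integrable_norm_pow (by norm_num)
  rw [integral_eq_zero_iff_of_nonneg (fun x => by positivity) hi] at h
  have h2 := Measure.eq_of_ae_eq h (by fun_prop) continuous_const
  ext x
  simpa using congrFun h2 x

theorem schwartz_mul_integrable {E : Type} [NormedAddCommGroup E] [NormedSpace ℝ E]
    [MeasurableSpace E] [BorelSpace E] [FiniteDimensional ℝ E] {μ : Measure E}
    [μ.IsAddHaarMeasure] (u v : 𝓢(E, ℂ)) : Integrable (fun x => u x * v x) μ :=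
  (SchwartzMap.pairing (ContinuousLinearMap.mul ℂ ℂ) u v).integrable

/-- Pointwise complex conjugation of Schwartz functions. -/
def conjSchwartz {E : Type} [NormedAddCommGroup E] [NormedSpace ℝ E] (u : 𝓢(E, ℂ)) : 𝓢(E, ℂ) :=
  SchwartzMap.postcompCLM (𝕜 := ℝ) (Complex.conjCLE : ℂ →L[ℝ] ℂ) u

@[simp]
theorem conjSchwartz_apply {E : Type} [NormedAddCommGroup E] [NormedSpace ℝ E] (u : 𝓢(E, ℂ))
    (x : E) : conjSchwartz u x = conj (u x) := rfl

/-- The kernel `conj (K (x'', x'))` of the adjoint operator. -/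
def adjointKer (K : Ker N) : Ker N :=
  conjSchwartz (SchwartzMap.compCLMOfContinuousLinearEquiv ℂ
    (ContinuousLinearEquiv.prodComm ℝ (Conf N) (Conf N)) K)

@[simp]
theorem adjointKer_apply (K : Ker N) (x y : Conf N) : adjointKer K (x, y) = conj (K (y, x)) := rfl

theorem schwartz_eq_of_integral_mul {E : Type} [NormedAddCommGroup E] [NormedSpace ℝ E]
    [MeasurableSpace E] [BorelSpace E] [FiniteDimensional ℝ E] {μ : Measure E}
    [μ.IsAddHaarMeasure] (u v : 𝓢(E, ℂ))
    (h : ∀ w : 𝓢(E, ℂ), ∫ x, w x * u x ∂μ = ∫ x, w x * v x ∂μ) : u = v := by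
  rw [← sub_eq_zero]
  refine schwartz_eq_zero_of_integral (μ := μ) _ ?_
  have h1 := h (conjSchwartz (u - v))
  rw [← sub_eq_zero, ← integral_sub (schwartz_mul_integrable _ _) (schwartz_mul_integrable _ _)]
    at h1
  rw [← h1]
  refine integral_congr_ae (.of_forall fun x => ?_)
  simp [mul_sub]

theorem op_eq_of_braket {A B : Op N} (h : ∀ φ ψ, braket φ (A ψ) = braket φ (B ψ)) : A = B := by
  ext1 ψ
  refine schwartz_eq_of_integral_mul (μ := volume) _ _ fun w => ?_
  simpa [braket] using h (conjSchwartz w) ψ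

theorem braket_conj_symm (φ ψ : 𝓢(Conf N, ℂ)) : conj (braket φ ψ) = braket ψ φ := by
  unfold braket
  rw [← integral_conj]
  simp [mul_comm]

theorem braket_integrable (φ ψ : 𝓢(Conf N, ℂ)) :
    Integrable (fun x => conj (φ x) * ψ x) :=
  schwartz_mul_integrable (conjSchwartz φ) ψ

theorem braket_add_right (φ ψ χ : 𝓢(Conf N, ℂ)) :
    braket φ (ψ + χ) = braket φ ψ + braket φ χ := by
  unfold braket
  rw [← integral_add (braket_integrable φ ψ) (braket_integrable φ χ)]
  simp [mul_add]

theorem braket_smul_right (c : ℂ) (φ ψ : 𝓢(Conf N, ℂ)) :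
    braket φ (c • ψ) = c * braket φ ψ := by
  unfold braket
  rw [← integral_const_mul]
  simp [mul_left_comm]

theorem braket_add_left (φ ψ χ : 𝓢(Conf N, ℂ)) :
    braket (φ + ψ) χ = braket φ χ + braket ψ χ := by
  rw [← braket_conj_symm, braket_add_right, map_add, braket_conj_symm, braket_conj_symm]

theorem braket_smul_left (c : ℂ) (φ ψ : 𝓢(Conf N, ℂ)) :
    braket (c • φ) ψ = conj c * braket φ ψ := by
  rw [← braket_conj_symm, braket_smul_right, map_mul, braket_conj_symm]

namespace IsAdjoint

variable {A B A' B' : Op N}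

theorem symm (h : IsAdjoint A A') : IsAdjoint A' A := fun φ ψ => by
  rw [← braket_conj_symm, ← h, braket_conj_symm]

theorem unique (h : IsAdjoint A B) (h' : IsAdjoint A B') : B = B' :=
  op_eq_of_braket fun φ ψ => by rw [h.symm, h'.symm]

theorem add (hA : IsAdjoint A A') (hB : IsAdjoint B B') : IsAdjoint (A + B) (A' + B') :=
  fun φ ψ => by
    rw [LinearMap.add_apply, LinearMap.add_apply, braket_add_right, braket_add_left, hA, hB]

theorem smul (c : ℂ) (hA : IsAdjoint A A') : IsAdjoint (c • A) (conj c • A') :=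
  fun φ ψ => by
    rw [LinearMap.smul_apply, LinearMap.smul_apply, braket_smul_right, braket_smul_left, hA]
    simp

theorem mul (hA : IsAdjoint A A') (hB : IsAdjoint B B') : IsAdjoint (A * B) (B' * A') :=
  fun φ ψ => by rw [Module.End.mul_apply, Module.End.mul_apply, hA, hB]

/-- `dagger` is defined by choice; uniqueness of adjoints determines the choice. -/
theorem dagger_eq (h : IsAdjoint A A') : dagger A = A' := by
  have hex : ∃ B, IsAdjoint A B := ⟨A', h⟩
  rw [dagger, dif_pos hex]
  exact hex.choose_spec.unique h

end IsAdjoint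

theorem integrable_kernel_mul (K : Ker N) (ψ : 𝓢(Conf N, ℂ)) (x : Conf N) :
    Integrable (fun y => K (x, y) * ψ y) :=
  schwartz_mul_integrable (rowCLM x K) ψ

namespace HasKernel

variable {A B : Op N}

/-- Each row of the kernel is determined by its pairings with Schwartz functions. This finally
identifies the time derivative of the kernel with the computed kernel of the generator. -/
theorem kernel_unique {K K' : Ker N} (h : HasKernel A K) (h' : HasKernel A K') : K = K' := by
  ext ⟨x, y⟩
  have : rowCLM x K = rowCLM x K' :=
    schwartz_eq_of_integral_mul (μ := volume) _ _ fun w => by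
      simp_rw [rowCLM_apply, mul_comm (w _)]
      rw [← h, ← h']
  exact DFunLike.congr_fun this y

theorem op_unique {K : Conf N × Conf N → ℂ} (h : HasKernel A K) (h' : HasKernel B K) : A = B := by
  ext ψ x
  rw [h, h']

theorem add {K K' : Ker N} (h : HasKernel A K) (h' : HasKernel B K') :
    HasKernel (A + B) (K + K' : Ker N) := fun ψ x => by
  rw [LinearMap.add_apply, add_apply, h, h',
    ← integral_add (integrable_kernel_mul K ψ x) (integrable_kernel_mul K' ψ x)]
  simp [add_mul]

theorem smul {K : Ker N} (c : ℂ) (h : HasKernel A K) :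
    HasKernel (c • A) (c • K : Ker N) := fun ψ x => by
  rw [LinearMap.smul_apply, smul_apply, h, smul_eq_mul, ← integral_const_mul]
  simp [mul_assoc]

theorem sub {K K' : Ker N} (h : HasKernel A K) (h' : HasKernel B K') :
    HasKernel (A - B) (K - K' : Ker N) := by
  simpa [sub_eq_add_neg] using h.add (h'.smul (-1))

theorem zero : HasKernel (0 : Op N) (0 : Ker N) := fun ψ x => by simp

theorem sum {ι : Type*} (s : Finset ι) {A : ι → Op N} {K : ι → Ker N}
    (h : ∀ i ∈ s, HasKernel (A i) (K i)) :
    HasKernel (∑ i ∈ s, A i) (∑ i ∈ s, K i : Ker N) := by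
  classical
  induction s using Finset.induction_on with
  | empty => simpa using zero
  | insert i s hi ih =>
    rw [Finset.sum_insert hi, Finset.sum_insert hi]
    exact (h i (by simp)).add (ih fun j hj => h j (by simp [hj]))

end HasKernel

theorem hasTemperateGrowth_fst (u : 𝓢(Conf N, ℂ)) :
    (fun q : Conf N × Conf N => u q.1).HasTemperateGrowth :=
  u.hasTemperateGrowth.comp (ContinuousLinearMap.fst ℝ (Conf N) (Conf N)).hasTemperateGrowth

theorem hasTemperateGrowth_snd (u : 𝓢(Conf N, ℂ)) :
    (fun q : Conf N × Conf N => u q.2).HasTemperateGrowth :=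
  u.hasTemperateGrowth.comp (ContinuousLinearMap.snd ℝ (Conf N) (Conf N)).hasTemperateGrowth

/-- The integral operator with a given Schwartz kernel. -/
def kernelOp (K : Ker N) : Op N where
  toFun ψ := integralSnd volume (SchwartzMap.smulLeftCLM ℂ (fun q : Conf N × Conf N => ψ q.2) K)
  map_add' ψ χ := by
    have h := hasTemperateGrowth_snd (N := N)
    ext x
    rw [add_apply]
    simp only [integralSnd_apply, SchwartzMap.smulLeftCLM_apply_apply (h _)]
    simp only [add_apply, smul_eq_mul, add_mul]
    rw [integral_add] <;> simpa only [mul_comm] using integrable_kernel_mul K _ x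
  map_smul' c ψ := by
    have h := hasTemperateGrowth_snd (N := N)
    ext x
    rw [smul_apply]
    simp only [integralSnd_apply, SchwartzMap.smulLeftCLM_apply_apply (h _)]
    simp only [smul_apply, smul_eq_mul, RingHom.id_apply, ← integral_const_mul,
      mul_assoc]

theorem hasKernel_kernelOp (K : Ker N) : HasKernel (kernelOp K) K := fun ψ x => by
  have h := hasTemperateGrowth_snd ψ
  change ∫ y, _ = _
  simp only [SchwartzMap.smulLeftCLM_apply_apply h, smul_eq_mul, mul_comm]

theorem HasKernel.isAdjoint {A B : Op N} {K : Ker N} (hA : HasKernel A K)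
    (hB : HasKernel B (adjointKer K)) : IsAdjoint A B := fun φ ψ => by
  have hi : Integrable (fun q : Conf N × Conf N => conj (φ q.1) * (K q * ψ q.2))
      ((volume : Measure (Conf N)).prod volume) := by
    have h1 := hasTemperateGrowth_snd ψ
    have h2 := hasTemperateGrowth_fst (conjSchwartz φ)
    have := (SchwartzMap.smulLeftCLM ℂ (fun q : Conf N × Conf N => conjSchwartz φ q.1)
      (SchwartzMap.smulLeftCLM ℂ (fun q : Conf N × Conf N => ψ q.2) K)).integrable
      (μ := volume)
    refine this.congr (.of_forall fun q => ?_)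
    rw [SchwartzMap.smulLeftCLM_apply_apply h2, SchwartzMap.smulLeftCLM_apply_apply h1]
    simp [mul_comm]
  unfold braket
  simp_rw [hA ψ, hB φ, ← integral_conj, ← integral_const_mul, ← integral_mul_const]
  rw [integral_integral_swap hi]
  refine integral_congr_ae (.of_forall fun y => integral_congr_ae (.of_forall fun x => ?_))
  simp
  ring

/-- An operator with Schwartz kernel always has an adjoint, by Fubini, so the h.c. term of the
master equation never takes the default value of `dagger`. -/
theorem HasKernel.dagger {A : Op N} {K : Ker N} (hA : HasKernel A K) :
    HasKernel (dagger A) (adjointKer K) := by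
  rw [(hA.isAdjoint (hasKernel_kernelOp (adjointKer K))).dagger_eq]
  exact hasKernel_kernelOp _

/-! ### Tensor products of Schwartz functions -/

/-- Leibniz formula. The projections have norm at most one, and for the maximum norm `‖q‖ ^ k ≤
‖q.1‖ ^ k + ‖q.2‖ ^ k`, so the weight can be given to one factor at a time. -/
theorem schwartz_tensor_decay (u v : 𝓢(Conf N, ℂ)) (k n : ℕ) : ∃ C, ∀ q : Conf N × Conf N,
    ‖q‖ ^ k * ‖iteratedFDeriv ℝ n (fun q : Conf N × Conf N => u q.1 * v q.2) q‖ ≤ C := by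
  have hu : ContDiff ℝ ∞ (fun q : Conf N × Conf N => u q.1) := (u.smooth ⊤).comp contDiff_fst
  have hv : ContDiff ℝ ∞ (fun q : Conf N × Conf N => v q.2) := (v.smooth ⊤).comp contDiff_snd
  have h1 (i : ℕ) (q : Conf N × Conf N) :
      ‖iteratedFDeriv ℝ i (fun q : Conf N × Conf N => u q.1) q‖ ≤ ‖iteratedFDeriv ℝ i u q.1‖ := by
    have := (ContinuousLinearMap.fst ℝ (Conf N) (Conf N)).iteratedFDeriv_comp_right
      (u.smooth ⊤) q (i := i) (by exact_mod_cast le_top)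
    rw [show (fun q : Conf N × Conf N => u q.1) = u ∘ ContinuousLinearMap.fst ℝ (Conf N) (Conf N)
      from rfl, this]
    refine (ContinuousMultilinearMap.norm_compContinuousLinearMap_le _ _).trans ?_
    refine mul_le_of_le_one_right (norm_nonneg _) (Finset.prod_le_one (by simp) fun _ _ => ?_)
    exact ContinuousLinearMap.norm_fst_le ..
  have h2 (i : ℕ) (q : Conf N × Conf N) :
      ‖iteratedFDeriv ℝ i (fun q : Conf N × Conf N => v q.2) q‖ ≤ ‖iteratedFDeriv ℝ i v q.2‖ := by
    have := (ContinuousLinearMap.snd ℝ (Conf N) (Conf N)).iteratedFDeriv_comp_right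
      (v.smooth ⊤) q (i := i) (by exact_mod_cast le_top)
    rw [show (fun q : Conf N × Conf N => v q.2) = v ∘ ContinuousLinearMap.snd ℝ (Conf N) (Conf N)
      from rfl, this]
    refine (ContinuousMultilinearMap.norm_compContinuousLinearMap_le _ _).trans ?_
    refine mul_le_of_le_one_right (norm_nonneg _) (Finset.prod_le_one (by simp) fun _ _ => ?_)
    exact ContinuousLinearMap.norm_snd_le ..
  choose a ha0 ha using u.decay
  choose b hb0 hb using v.decay
  refine ⟨∑ i ∈ Finset.range (n + 1), n.choose i *
    (a k i * b 0 (n - i) + a 0 i * b k (n - i)), fun q => ?_⟩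
  refine (mul_le_mul_of_nonneg_left (norm_iteratedFDeriv_mul_le hu hv q (n := n)
    (by exact_mod_cast le_top)) (by positivity)).trans ?_
  rw [Finset.mul_sum]
  refine Finset.sum_le_sum fun i _ => ?_
  have hq : ‖q‖ ^ k ≤ ‖q.1‖ ^ k + ‖q.2‖ ^ k := by
    rcases max_cases ‖q.1‖ ‖q.2‖ with h | h <;> rw [Prod.norm_def, h.1]
    · exact le_add_of_nonneg_right (by positivity)
    · exact le_add_of_nonneg_left (by positivity)
  have ha' := ha 0 i q.1
  have hb' := hb 0 (n - i) q.2
  rw [pow_zero, one_mul] at ha' hb'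
  have ha1 := ha k i q.1
  have hb1 := hb k (n - i) q.2
  have h1' := h1 i q
  have h2' := h2 (n - i) q
  have hak := (ha0 k i).le
  have ha0' := (ha0 0 i).le
  have e1 := norm_nonneg (iteratedFDeriv ℝ i (fun q : Conf N × Conf N => u q.1) q)
  have e2 := norm_nonneg (iteratedFDeriv ℝ (n - i) (fun q : Conf N × Conf N => v q.2) q)
  have e3 := norm_nonneg (iteratedFDeriv ℝ i u q.1)
  have e4 := norm_nonneg (iteratedFDeriv ℝ (n - i) v q.2)
  generalize ‖iteratedFDeriv ℝ i (fun q : Conf N × Conf N => u q.1) q‖ = a1 at *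
  generalize ‖iteratedFDeriv ℝ (n - i) (fun q : Conf N × Conf N => v q.2) q‖ = a2 at *
  generalize ‖iteratedFDeriv ℝ i u q.1‖ = a3 at *
  generalize ‖iteratedFDeriv ℝ (n - i) v q.2‖ = a4 at *
  calc ‖q‖ ^ k * (n.choose i * a1 * a2)
      ≤ (‖q.1‖ ^ k + ‖q.2‖ ^ k) * (n.choose i * a3 * a4) := by gcongr
    _ = n.choose i * ((‖q.1‖ ^ k * a3) * a4 + a3 * (‖q.2‖ ^ k * a4)) := by ring
    _ ≤ _ := by gcongr

/-- The kernel of `|ψ⟩⟨φ|`. -/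
def rankOneKer (ψ φ : 𝓢(Conf N, ℂ)) : Ker N where
  toFun q := ψ q.1 * conjSchwartz φ q.2
  smooth' := ((ψ.smooth ⊤).comp contDiff_fst).mul (((conjSchwartz φ).smooth ⊤).comp contDiff_snd)
  decay' k n := schwartz_tensor_decay ψ (conjSchwartz φ) k n

theorem rankOneKer_coe (ψ φ : 𝓢(Conf N, ℂ)) :
    (rankOneKer ψ φ : Conf N × Conf N → ℂ) = fun q => ψ q.1 * conj (φ q.2) := rfl

/-- The operator `|ψ⟩⟨φ|`. -/
def rankOneOp (ψ φ : 𝓢(Conf N, ℂ)) : Op N where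
  toFun χ := braket φ χ • ψ
  map_add' χ χ' := by rw [braket_add_right, add_smul]
  map_smul' c χ := by rw [braket_smul_right, mul_smul, RingHom.id_apply]

theorem rankOneOp_apply (ψ φ χ : 𝓢(Conf N, ℂ)) : rankOneOp ψ φ χ = braket φ χ • ψ := rfl

theorem mul_rankOneOp (A : Op N) (ψ φ : 𝓢(Conf N, ℂ)) :
    A * rankOneOp ψ φ = rankOneOp (A ψ) φ := by
  ext1 χ
  simp [rankOneOp_apply]

theorem hasKernel_rankOneOp (ψ φ : 𝓢(Conf N, ℂ)) :
    HasKernel (rankOneOp ψ φ) (rankOneKer ψ φ) := fun χ x => by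
  simp_rw [rankOneOp_apply, rankOneKer_coe, braket, smul_apply, smul_eq_mul,
    ← integral_mul_const]
  refine integral_congr_ae (.of_forall fun y => ?_)
  simp
  ring

end WignerFlow

end

/-! ### Canonical commutation relations, the action of the generators on kernels, and the trace. -/

noncomputable section

namespace WignerFlow

variable {N : ℕ}

open MeasureTheory

/-! ### Multiplication by linear forms and directional derivatives -/

section LinDer

variable {E : Type} [NormedAddCommGroup E] [NormedSpace ℝ E]

/-- Multiplication of Schwartz functions by a real linear form. -/
def mulForm (l : E →L[ℝ] ℝ) : Module.End ℂ 𝓢(E, ℂ) :=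
  (SchwartzMap.smulLeftCLM ℂ (fun x : E => ((l x : ℝ) : ℂ))).toLinearMap

/-- The derivative of Schwartz functions in a direction. -/
def derivAlong (v : E) : Module.End ℂ 𝓢(E, ℂ) :=
  (LineDeriv.lineDerivOpCLM ℂ 𝓢(E, ℂ) v).toLinearMap

@[simp]
theorem mulForm_apply (l : E →L[ℝ] ℝ) (u : 𝓢(E, ℂ)) (x : E) :
    mulForm l u x = ((l x : ℝ) : ℂ) * u x :=
  SchwartzMap.smulLeftCLM_apply_apply (Complex.ofRealCLM.comp l).hasTemperateGrowth u x

@[simp]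
theorem derivAlong_apply (v : E) (u : 𝓢(E, ℂ)) (x : E) : derivAlong v u x = fderiv ℝ u x v :=
  SchwartzMap.lineDerivOp_apply_eq_fderiv ..

theorem derivAlong_eq_fderiv (v : E) (u : 𝓢(E, ℂ)) :
    (derivAlong v u : E → ℂ) = fun x => fderiv ℝ u x v :=
  funext fun x => derivAlong_apply v u x

theorem derivAlong_add_left (v w : E) : derivAlong (v + w) = derivAlong v + derivAlong w := by
  ext u x
  simp

theorem derivAlong_smul_left (c : ℝ) (v : E) : derivAlong (c • v) = (c : ℂ) • derivAlong v := by
  ext u x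
  simp

theorem derivAlong_comm (v w : E) : derivAlong v * derivAlong w = derivAlong w * derivAlong v := by
  ext u x
  have h (v w : E) : derivAlong v (derivAlong w u) x = fderiv ℝ (fderiv ℝ u) x v w := by
    have h1 : DifferentiableAt ℝ (fderiv ℝ u) x :=
      ((u.smooth 2).fderiv_right (m := 1) (by norm_num)).differentiable (by norm_num) x
    rw [derivAlong_apply, derivAlong_eq_fderiv, fderiv_clm_apply h1 (by fun_prop)]
    simp
  have h2 : IsSymmSndFDerivAt ℝ u x := (u.smooth 2).contDiffAt.isSymmSndFDerivAt (by simp)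
  change derivAlong v (derivAlong w u) x = derivAlong w (derivAlong v u) x
  rw [h, h, h2.eq]

theorem mulForm_comm (l m : E →L[ℝ] ℝ) : mulForm l * mulForm m = mulForm m * mulForm l := by
  ext u x
  simp only [Module.End.mul_apply, mulForm_apply]
  ring

/-- The Leibniz rule in the form of the canonical commutation relation. -/
theorem derivAlong_mulForm (v : E) (l : E →L[ℝ] ℝ) :
    derivAlong v * mulForm l = mulForm l * derivAlong v + ((l v : ℝ) : ℂ) • 1 := by
  ext u x
  have h1 : HasFDerivAt (fun x => ((l x : ℝ) : ℂ)) (Complex.ofRealCLM.comp l) x :=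
    (Complex.ofRealCLM.comp l).hasFDerivAt
  have h2 := h1.mul (u.hasFDerivAt x)
  have h3 : (mulForm l u : E → ℂ) = fun x => ((l x : ℝ) : ℂ) * u x :=
    funext fun x => mulForm_apply l u x
  simp only [Module.End.mul_apply, derivAlong_apply, mulForm_apply, LinearMap.add_apply,
    LinearMap.smul_apply, Module.End.one_apply, add_apply, smul_apply]
  rw [h3]
  erw [h2.fderiv]
  simp [mul_comm]

variable [MeasurableSpace E] [BorelSpace E] [FiniteDimensional ℝ E] (μ : Measure E)
  [μ.IsAddHaarMeasure]

theorem integral_derivAlong (v : E) (u : 𝓢(E, ℂ)) : ∫ x, derivAlong v u x ∂μ = 0 := by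
  have h := integral_bilinear_hasLineDerivAt_right_eq_neg_left_of_integrable (μ := μ)
    (f := fun _ : E => (1 : ℂ)) (f' := fun _ => 0) (g := u) (g' := derivAlong v u) (v := v)
    (B := ContinuousLinearMap.mul ℝ ℂ) (by simp) (by simpa only [ContinuousLinearMap.mul_apply', one_mul] using (derivAlong v u).integrable)
    (by simpa using u.integrable) (fun x _ => (hasFDerivAt_const (1 : ℂ) x).hasLineDerivAt v)
    (fun x _ => by simpa using (u.hasFDerivAt x).hasLineDerivAt v)
  simpa using h

theorem integral_mul_derivAlong (v : E) (u w : 𝓢(E, ℂ)) :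
    ∫ x, u x * derivAlong v w x ∂μ = -∫ x, derivAlong v u x * w x ∂μ :=
  SchwartzMap.integral_mul_lineDerivOp_right_eq_neg_left u w v

end LinDer

/-! ### The generators and their action on kernels -/

/-- Indices of the phase-space coordinates: `Sum.inl n` for `pₙ` and `Sum.inr n` for `xₙ`. -/
abbrev Idx (N : ℕ) : Type := Fin N ⊕ Fin N

/-- The coordinate `xₙ` as a linear form. -/
def coord (n : Fin N) : Conf N →L[ℝ] ℝ := EuclideanSpace.proj n

@[simp]
theorem coord_apply (n : Fin N) (x : Conf N) : coord n x = x n := rfl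

theorem posOp_eq (n : Fin N) : posOp n = mulForm (coord n) := rfl

theorem momOp_eq (ħ : ℝ) (n : Fin N) :
    momOp ħ n = (-Complex.I * (ħ : ℂ)) • derivAlong (unitVec n) := rfl

/-- The operators `p̂ₙ` and `x̂ₙ`. -/
def gen (ħ : ℝ) : Idx N → Op N := Sum.elim (momOp ħ) posOp

/-- The action on kernels of left multiplication by `p̂ₙ` and `x̂ₙ`. -/
def genLeft (ħ : ℝ) : Idx N → Module.End ℂ (Ker N) :=
  Sum.elim (fun n => (-Complex.I * (ħ : ℂ)) • derivAlong (unitVec n, 0))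
    (fun n => mulForm ((coord n).comp (ContinuousLinearMap.fst ℝ _ _)))

/-- The action on kernels of right multiplication by `p̂ₙ` and `x̂ₙ`. -/
def genRight (ħ : ℝ) : Idx N → Module.End ℂ (Ker N) :=
  Sum.elim (fun n => (Complex.I * (ħ : ℂ)) • derivAlong (0, unitVec n))
    (fun n => mulForm ((coord n).comp (ContinuousLinearMap.snd ℝ _ _)))

theorem gen_commutator (ħ : ℝ) (i j : Idx N) :
    ∃ c : ℂ, gen ħ i * gen ħ j = gen ħ j * gen ħ i + c • 1 := by
  rcases i with n | n <;> rcases j with m | m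
  · refine ⟨0, ?_⟩
    simp only [gen, Sum.elim_inl, momOp_eq, smul_mul_smul_comm]
    rw [derivAlong_comm]
    simp
  · refine ⟨-Complex.I * ħ * (coord m (unitVec n) : ℝ), ?_⟩
    simp only [gen, Sum.elim_inl, Sum.elim_inr, momOp_eq, posOp_eq, smul_mul_assoc,
      derivAlong_mulForm, mul_smul_comm, smul_add, mul_smul]
  · refine ⟨Complex.I * ħ * (coord n (unitVec m) : ℝ), ?_⟩
    simp only [gen, Sum.elim_inl, Sum.elim_inr, momOp_eq, posOp_eq, smul_mul_assoc,
      derivAlong_mulForm, smul_add, neg_mul, neg_smul]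
    rw [neg_add, smul_smul, neg_add_cancel_right, mul_neg, mul_smul_comm]
  · exact ⟨0, by simp [gen, posOp_eq, mulForm_comm (coord n)]⟩

/-- Left and right multiplication act on different variables of the kernel. -/
theorem genLeft_genRight_comm (ħ : ℝ) (i j : Idx N) :
    genLeft ħ i * genRight ħ j = genRight ħ j * genLeft ħ i := by
  rcases i with n | n <;> rcases j with m | m
  · simp only [genLeft, genRight, Sum.elim_inl, smul_mul_smul_comm]
    rw [derivAlong_comm, mul_comm (-Complex.I * (ħ : ℂ))]
  · simp [genLeft, genRight, derivAlong_mulForm]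
  · simp [genLeft, genRight, derivAlong_mulForm]
  · simp only [genLeft, genRight, Sum.elim_inr, mulForm_comm]

/-- For the momenta, the sign from integration by parts is compensated by conjugating `-iħ`. -/
theorem isAdjoint_gen (ħ : ℝ) (i : Idx N) : IsAdjoint (gen ħ i) (gen ħ i) := fun φ ψ => by
  rcases i with n | n
  · simp only [gen, Sum.elim_inl, momOp_eq, LinearMap.smul_apply, braket_smul_right,
      braket_smul_left]
    have h := integral_mul_derivAlong volume (unitVec n) (conjSchwartz φ) ψ
    have h2 : ∀ x, derivAlong (unitVec n) (conjSchwartz φ) x = conj (derivAlong (unitVec n) φ x) := by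
      intro x
      rw [derivAlong_apply, derivAlong_apply]
      have := (Complex.conjCLE.toContinuousLinearMap.hasFDerivAt (x := φ x)).comp x
        (φ.hasFDerivAt x)
      erw [this.fderiv]
      rfl
    simp only [conjSchwartz_apply, h2] at h
    simp only [braket, h, map_mul, map_neg, Complex.conj_I, Complex.conj_ofReal]
    ring
  · unfold braket
    refine integral_congr_ae (.of_forall fun x => ?_)
    simp only [gen, Sum.elim_inr, posOp_apply, map_mul, Complex.conj_ofReal]
    ring

theorem HasKernel.gen_mul {ħ : ℝ} {A : Op N} {K : Ker N} (h : HasKernel A K) (i : Idx N) :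
    HasKernel (gen ħ i * A) (genLeft ħ i K) := fun ψ x => by
  rcases i with n | n
  -- This presents `A ψ` as a partial integral of the Schwartz function `G`, which may be
  -- differentiated under the integral sign.
  · have h1 : A = kernelOp K := h.op_unique (hasKernel_kernelOp K)
    have ht := hasTemperateGrowth_snd ψ
    set G := SchwartzMap.smulLeftCLM ℂ (fun q : Conf N × Conf N => ψ q.2) K with hG
    have hA : (A ψ : Conf N → ℂ) = fun x => ∫ y, G (x, y) := by rw [h1]; rfl
    have hG' : (G : Conf N × Conf N → ℂ) = fun q => ψ q.2 * K q := by
      ext q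
      rw [hG, SchwartzMap.smulLeftCLM_apply_apply ht, smul_eq_mul]
    have h2 : ∀ y, fderivFst G (x, y) (unitVec n) =
        derivAlong (unitVec n, 0) K (x, y) * ψ y := by
      intro y
      have h4 := ((ψ.hasFDerivAt y).comp (x, y) (hasFDerivAt_snd (𝕜 := ℝ) (p := (x, y)))).mul
        (K.hasFDerivAt (x, y))
      rw [fderivFst_apply, hG', derivAlong_apply]
      erw [h4.fderiv]
      simp [mul_comm]
    simp only [gen, genLeft, Sum.elim_inl, Module.End.mul_apply, momOp_eq, LinearMap.smul_apply,
      smul_apply, smul_eq_mul]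
    rw [derivAlong_apply, hA, (hasFDerivAt_integral_section volume G x).fderiv,
      ContinuousLinearMap.integral_apply (integrable_schwartz_section volume _ x)]
    simp only [h2, mul_assoc, integral_const_mul]
  · simp only [gen, genLeft, Sum.elim_inr, Module.End.mul_apply, posOp_apply, mulForm_apply, h ψ x]
    rw [← integral_const_mul]
    simp [mul_assoc]

/-- Integration by parts moves the derivative from `ψ` to the second variable of the kernel; hence
the sign `+iħ` in `genRight`. -/
theorem HasKernel.mul_gen {ħ : ℝ} {A : Op N} {K : Ker N} (h : HasKernel A K) (i : Idx N) :
    HasKernel (A * gen ħ i) (genRight ħ i K) := fun ψ x => by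
  rw [Module.End.mul_apply, h]
  rcases i with n | n
  · have h1 := integral_mul_derivAlong volume (unitVec n) (rowCLM x K) ψ
    have h2 : ∀ y, derivAlong (unitVec n) (rowCLM x K) y = derivAlong (0, unitVec n) K (x, y) := by
      intro y
      rw [derivAlong_apply, derivAlong_apply]
      have := (K.hasFDerivAt (x, y)).comp y (hasFDerivAt_prodMk_right x y)
      erw [this.fderiv]
      rfl
    simp only [rowCLM_apply, h2] at h1
    simp only [gen, genRight, Sum.elim_inl, momOp_eq, LinearMap.smul_apply, smul_apply,
      smul_eq_mul, mul_left_comm (K _)]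
    rw [integral_const_mul, h1]
    simp only [mul_assoc, integral_const_mul]
    ring
  · refine integral_congr_ae (.of_forall fun y => ?_)
    simp [gen, genRight, posOp_apply]
    ring

/-! ### The trace -/

/-- The trace of the operator with a given kernel. -/
def kerTrace : Ker N →ₗ[ℂ] ℂ :=
  (SchwartzMap.integralCLM ℂ volume).toLinearMap ∘ₗ diagCLM.toLinearMap

theorem kerTrace_apply (K : Ker N) : kerTrace K = ∫ x, K (x, x) := rfl

/-- Cyclicity of the trace for a generator. For the momenta, the sum of the two partial derivatives
on the diagonal is the derivative of the restriction to the diagonal, whose integral vanishes. -/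
theorem kerTrace_genLeft (ħ : ℝ) (i : Idx N) (K : Ker N) :
    kerTrace (genLeft ħ i K) = kerTrace (genRight ħ i K) := by
  rcases i with n | n
  · have h := integral_derivAlong volume (unitVec n) (diagCLM K)
    have h2 : ∀ y, derivAlong (unitVec n) (diagCLM K) y =
        (derivAlong (unitVec n, 0) K + derivAlong (0, unitVec n) K) (y, y) := by
      intro y
      rw [← LinearMap.add_apply, ← derivAlong_add_left, derivAlong_apply, derivAlong_apply]
      have := HasFDerivAt.comp (f := fun y => (y, y)) y (K.hasFDerivAt (y, y))
        ((hasFDerivAt_id y).prodMk (hasFDerivAt_id y))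
      erw [this.fderiv]
      simp
    have h3 : kerTrace (derivAlong (unitVec n, 0) K + derivAlong (0, unitVec n) K) = 0 := by
      rw [kerTrace_apply]
      simpa only [h2] using h
    rw [map_add, add_eq_zero_iff_eq_neg] at h3
    simp [genLeft, genRight, h3]
  · simp [genLeft, genRight, kerTrace_apply]

end WignerFlow

end

/-! ### The Wigner transform: regularity, Bopp shifts, integrability and trace. -/

noncomputable section

namespace WignerFlow

variable {N : ℕ}

open MeasureTheory FourierTransform

/-! ### The Wigner transform of Schwartz kernels -/

/-- The end points of the chord with midpoint `x` and direction `l`. -/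
def chord (x l : Conf N) : Conf N × Conf N := (x + (1 / 2 : ℝ) • l, x - (1 / 2 : ℝ) • l)

theorem antilipschitz_chord (x : Conf N) : AntilipschitzWith 2 (chord x) :=
  AntilipschitzWith.of_le_mul_dist fun l m => by
    rw [chord, chord, Prod.dist_eq, dist_add_left, dist_smul₀]
    simp only [NNReal.coe_ofNat]
    calc dist l m = 2 * (‖(1 / 2 : ℝ)‖ * dist l m) := by norm_num; ring
      _ ≤ _ := by gcongr; exact le_max_left _ _

theorem chord_eq (x l : Conf N) : chord x l =
    (((1 / 2 : ℝ) • ContinuousLinearMap.id ℝ (Conf N)).prod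
      (-((1 / 2 : ℝ) • ContinuousLinearMap.id ℝ (Conf N)))) l + (x, x) := by
  ext <;> simp [chord] <;> ring

/-- The restriction of a kernel to chords with midpoint `x`. -/
def chordCLM (x : Conf N) : Ker N →L[ℂ] 𝓢(Conf N, ℂ) :=
  SchwartzMap.compCLMOfAntilipschitz ℂ (g := chord x)
    (by
      rw [funext (chord_eq x)]
      exact (ContinuousLinearMap.hasTemperateGrowth _).add (.const _))
    (antilipschitz_chord x)

@[simp]
theorem chordCLM_apply (x : Conf N) (K : Ker N) (l : Conf N) :
    chordCLM x K l = K (chord x l) := rfl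

theorem derivAlong_chordCLM (x : Conf N) (K : Ker N) (l v : Conf N) :
    derivAlong v (chordCLM x K) l =
      chordCLM x ((1 / 2 : ℂ) • derivAlong (v, -v) K) l := by
  have h1 : HasFDerivAt (chord x) (((1 / 2 : ℝ) • ContinuousLinearMap.id ℝ (Conf N)).prod
      (-((1 / 2 : ℝ) • ContinuousLinearMap.id ℝ (Conf N)))) l := by
    rw [funext (chord_eq x)]
    exact (ContinuousLinearMap.hasFDerivAt _).add_const _
  have h2 := (K.hasFDerivAt (chord x l)).comp l h1
  have h3 : (((1 / 2 : ℝ) • ContinuousLinearMap.id ℝ (Conf N)).prod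
      (-((1 / 2 : ℝ) • ContinuousLinearMap.id ℝ (Conf N)))) v = (1 / 2 : ℝ) • (v, -v) := by
    ext <;> simp
  rw [derivAlong_apply, chordCLM_apply, smul_apply, derivAlong_apply]
  erw [h2.fderiv]
  rw [ContinuousLinearMap.comp_apply, h3, map_smul, Complex.real_smul, smul_eq_mul]
  push_cast
  rfl

variable (ħ : ℝ)

/-- The phase factor `exp (-i p·l/ħ)`. -/
def phase (p l : Conf N) : ℂ :=
  Complex.exp (-Complex.I * ((inner ℝ p l : ℝ) : ℂ) / (ħ : ℂ))

theorem norm_phase (p l : Conf N) : ‖phase ħ p l‖ = 1 := by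
  rw [phase, show -Complex.I * ((inner ℝ p l : ℝ) : ℂ) / (ħ : ℂ) =
    ((-(inner ℝ p l / ħ) : ℝ) : ℂ) * Complex.I by push_cast; ring, Complex.norm_exp_ofReal_mul_I]

theorem wigner_apply (K : Ker N) (z : Phase N) :
    wigner ħ K z = (((2 * Real.pi * ħ) ^ N : ℝ) : ℂ)⁻¹ *
      ∫ l, chordCLM z.2 K l * phase ħ z.1 l := rfl

/-- The Fourier transform here carries the phase `exp (-2πi ⟨l, w⟩)`, so the frequency is `w = p /
(2πħ)`. -/
theorem wigner_eq_fourier (K : Ker N) (z : Phase N) :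
    wigner ħ K z = (((2 * Real.pi * ħ) ^ N : ℝ) : ℂ)⁻¹ *
      𝓕 (chordCLM z.2 K) ((2 * Real.pi * ħ)⁻¹ • z.1) := by
  rw [wigner_apply, SchwartzMap.fourier_coe, Real.fourier_eq']
  congr 1
  refine integral_congr_ae (.of_forall fun l => ?_)
  simp only [smul_eq_mul]
  rw [mul_comm, phase, real_inner_smul_right, real_inner_comm]
  congr 2
  push_cast
  field_simp

/-- The Wigner transform of Schwartz kernels at a point. -/
def wignerCLM (z : Phase N) : Ker N →L[ℂ] ℂ :=
  (((2 * Real.pi * ħ) ^ N : ℝ) : ℂ)⁻¹ •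
    (BoundedContinuousFunction.evalCLM ℂ ((2 * Real.pi * ħ)⁻¹ • z.1) ∘L
      SchwartzMap.toBoundedContinuousFunctionCLM ℂ (Conf N) ℂ ∘L
      SchwartzMap.fourierTransformCLM ℂ ∘L chordCLM z.2)

/-- Provides linearity of the Wigner transform, and the continuity through which it commutes with
the time derivative. -/
theorem wignerCLM_apply (K : Ker N) (z : Phase N) : wignerCLM ħ z K = wigner ħ K z := by
  rw [wigner_eq_fourier]
  rfl

theorem wigner_add (K K' : Ker N) : wigner ħ (K + K' : Ker N) = wigner ħ K + wigner ħ K' := by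
  ext z
  simp only [Pi.add_apply, ← wignerCLM_apply, map_add]

theorem wigner_smul (c : ℂ) (K : Ker N) : wigner ħ (c • K : Ker N) = c • wigner ħ K := by
  ext z
  simp only [Pi.smul_apply, ← wignerCLM_apply, map_smul]

theorem wigner_sub (K K' : Ker N) : wigner ħ (K - K' : Ker N) = wigner ħ K - wigner ħ K' := by
  ext z
  simp only [Pi.sub_apply, ← wignerCLM_apply, map_sub]

theorem wigner_sum {ι : Type*} (s : Finset ι) (K : ι → Ker N) :
    wigner ħ (∑ i ∈ s, K i : Ker N) = ∑ i ∈ s, wigner ħ (K i) := by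
  ext z
  simp [← wignerCLM_apply]

/-- Conjugation reverses the phase and the adjoint exchanges the chord's end points; the
substitution `l ↦ -l` undoes both. -/
theorem wigner_adjointKer (K : Ker N) (z : Phase N) :
    wigner ħ (adjointKer K) z = conj (wigner ħ K z) := by
  rw [wigner_apply, wigner_apply, map_mul, ← integral_conj, ← integral_neg_eq_self]
  congr 1
  · rw [map_inv₀, Complex.conj_ofReal]
  · refine integral_congr_ae (.of_forall fun l => ?_)
    simp only [chordCLM_apply, map_mul, chord, adjointKer_apply, phase, ← Complex.exp_conj]
    simp [sub_eq_add_neg]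

/-- The chord vector is the difference of the end points, so `‖l‖ ≤ 2 * ‖chord x l‖` whatever the
midpoint; the bound is uniform in `x`. -/
theorem chord_decay {V : Type} [NormedAddCommGroup V] [NormedSpace ℝ V]
    (G : 𝓢(Conf N × Conf N, V)) (m : ℕ) :
    ∃ C : ℝ, 0 ≤ C ∧ ∀ x l, (1 + ‖l‖) ^ m * ‖G (chord x l)‖ ≤ C := by
  have h := fun z => SchwartzMap.one_add_le_sup_seminorm_apply (𝕜 := ℝ) (m := (m, 0))
    (k := m) (n := 0) le_rfl le_rfl G z
  refine ⟨_, mul_nonneg (pow_nonneg zero_le_two m) (le_trans (by positivity) (h 0)),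
    fun x l => (le_trans ?_ (mul_le_mul_of_nonneg_left (h (chord x l)) (pow_nonneg zero_le_two m)))⟩
  rw [norm_iteratedFDeriv_zero, ← mul_assoc, ← mul_pow]
  have h1 : ‖l‖ ≤ 2 * ‖chord x l‖ := by
    have h2 : l = (chord x l).1 - (chord x l).2 := by
      ext i
      simp [chord]
      ring
    calc ‖l‖ = ‖(chord x l).1 - (chord x l).2‖ := by rw [← h2]
      _ ≤ ‖(chord x l).1‖ + ‖(chord x l).2‖ := norm_sub_le _ _
      _ ≤ _ := by linarith [norm_fst_le (chord x l), norm_snd_le (chord x l)]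
  have h2 : 1 + ‖l‖ ≤ 2 * (1 + ‖chord x l‖) := by linarith
  gcongr

/-- The additional factor `1 + ‖l‖` absorbs the `l` that a momentum derivative brings down from the
phase. -/
theorem chord_decay_rpow {V : Type} [NormedAddCommGroup V] [NormedSpace ℝ V]
    (G : 𝓢(Conf N × Conf N, V)) (m : ℕ) :
    ∃ C : ℝ, 0 ≤ C ∧ ∀ x l, (1 + ‖l‖) * ‖G (chord x l)‖ ≤ C * (1 + ‖l‖) ^ (-(m : ℝ)) := by
  obtain ⟨C, hC, h⟩ := chord_decay G (m + 1)
  refine ⟨C, hC, fun x l => ?_⟩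
  rw [Real.rpow_neg (by positivity), Real.rpow_natCast, ← div_eq_mul_inv,
    le_div_iff₀ (by positivity)]
  refine le_trans (le_of_eq ?_) (h x l)
  ring

theorem exists_norm_wigner_le (K : Ker N) : ∃ C, ∀ z, ‖wigner ħ K z‖ ≤ C := by
  obtain ⟨C, -, hC⟩ := chord_decay_rpow K (volume : Measure (Conf N)).integrablePower
  have hi := (Measure.integrable_pow_neg_integrablePower (volume : Measure (Conf N))).const_mul C
  refine ⟨‖(((2 * Real.pi * ħ) ^ N : ℝ) : ℂ)⁻¹‖ * ∫ l : Conf N, C * (1 + ‖l‖) ^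
    (-((volume : Measure (Conf N)).integrablePower : ℝ)), fun z => ?_⟩
  rw [wigner_apply, norm_mul]
  refine mul_le_mul_of_nonneg_left (norm_integral_le_of_norm_le hi (.of_forall fun l => ?_))
    (norm_nonneg _)
  rw [norm_mul, norm_phase, mul_one, chordCLM_apply]
  refine le_trans ?_ (hC z.2 l)
  exact le_mul_of_one_le_left (norm_nonneg _) (by simp)

/-- The kernel whose Wigner transform is the derivative of that of `K` in the direction `v`. -/
def phaseDeriv (v : Phase N) : Module.End ℂ (Ker N) :=
  derivAlong (v.2, v.2) + (-Complex.I / (ħ : ℂ)) •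
    mulForm ((innerSL ℝ v.1).comp
      (ContinuousLinearMap.fst ℝ (Conf N) (Conf N) - ContinuousLinearMap.snd ℝ _ _))

/-- The derivative of the integrand of the Wigner transform with respect to the phase-space
point. -/
def integrandDeriv (K : Ker N) (z : Phase N) (l : Conf N) : Phase N →L[ℝ] ℂ :=
  K (chord z.2 l) • (phase ħ z.1 l • ((-Complex.I / (ħ : ℂ)) •
    (Complex.ofRealCLM.comp ((innerSL ℝ l).comp (ContinuousLinearMap.fst ℝ _ _))))) +
  phase ħ z.1 l • ((SchwartzMap.fderivCLM ℝ _ _ K (chord z.2 l)).comp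
    ((ContinuousLinearMap.snd ℝ _ _).prod (ContinuousLinearMap.snd ℝ _ _)))

theorem hasFDerivAt_integrand (K : Ker N) (z : Phase N) (l : Conf N) :
    HasFDerivAt (fun z : Phase N => K (chord z.2 l) * phase ħ z.1 l) (integrandDeriv ħ K z l) z := by
  have h1 : HasFDerivAt (fun z : Phase N => chord z.2 l)
      ((ContinuousLinearMap.snd ℝ _ _).prod (ContinuousLinearMap.snd ℝ _ _)) z :=
    (hasFDerivAt_snd.add_const _).prodMk (hasFDerivAt_snd.sub_const _)
  have h2 : HasFDerivAt (fun z : Phase N => -Complex.I * ((inner ℝ z.1 l : ℝ) : ℂ) / (ħ : ℂ))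
      ((-Complex.I / (ħ : ℂ)) •
    (Complex.ofRealCLM.comp ((innerSL ℝ l).comp (ContinuousLinearMap.fst ℝ _ _)))) z := by
    refine (ContinuousLinearMap.hasFDerivAt _).congr_of_eventuallyEq (.of_forall fun z => ?_)
    simp [real_inner_comm]
    ring
  exact ((K.hasFDerivAt _).comp z h1).mul h2.cexp

theorem continuous_chord (x : Conf N) : Continuous (chord x) := by
  unfold chord
  fun_prop

theorem continuous_phase (p : Conf N) : Continuous (phase ħ p) := by
  unfold phase
  fun_prop

theorem continuous_integrandDeriv (K : Ker N) (z : Phase N) :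
    Continuous (integrandDeriv ħ K z) := by
  have h1 := K.continuous.comp (continuous_chord z.2)
  have h2 := (SchwartzMap.fderivCLM ℝ _ _ K).continuous.comp (continuous_chord z.2)
  have h3 := continuous_phase ħ z.1
  have h4 : Continuous fun l : Conf N => Complex.ofRealCLM.comp ((innerSL ℝ l).comp
      (ContinuousLinearMap.fst ℝ (Conf N) (Conf N))) :=
    continuous_const.clm_comp ((innerSL ℝ).continuous.clm_comp continuous_const)
  have h5 : Continuous fun l : Conf N => (SchwartzMap.fderivCLM ℝ _ _ K (chord z.2 l)).comp
      ((ContinuousLinearMap.snd ℝ (Conf N) (Conf N)).prod (ContinuousLinearMap.snd ℝ _ _)) :=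
    h2.clm_comp continuous_const
  unfold integrandDeriv
  exact Continuous.add (Continuous.smul h1 (Continuous.smul h3 (Continuous.fun_const_smul h4 _)))
    (Continuous.smul h3 h5)

theorem norm_integrandDeriv_le (K : Ker N) (m : ℕ) :
    ∃ C, ∀ z l, ‖integrandDeriv ħ K z l‖ ≤ C * (1 + ‖l‖) ^ (-(m : ℝ)) := by
  obtain ⟨C₁, -, hC₁⟩ := chord_decay_rpow K m
  obtain ⟨C₂, -, hC₂⟩ := chord_decay_rpow (SchwartzMap.fderivCLM ℝ _ _ K) m
  set T : Phase N →L[ℝ] Conf N × Conf N :=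
    (ContinuousLinearMap.snd ℝ _ _).prod (ContinuousLinearMap.snd ℝ _ _) with hT
  refine ⟨‖-Complex.I / (ħ : ℂ)‖ * C₁ + C₂ * ‖T‖, fun z l => ?_⟩
  have e1 : ‖Complex.ofRealCLM.comp ((innerSL ℝ l).comp
      (ContinuousLinearMap.fst ℝ (Conf N) (Conf N)))‖ ≤ ‖l‖ := by
    refine (ContinuousLinearMap.opNorm_comp_le _ _).trans ?_
    rw [Complex.ofRealCLM_norm, one_mul]
    refine (ContinuousLinearMap.opNorm_comp_le _ _).trans ?_
    rw [innerSL_apply_norm]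
    exact mul_le_of_le_one_right (norm_nonneg _) (ContinuousLinearMap.norm_fst_le ..)
  have e2 : ‖l‖ * ‖K (chord z.2 l)‖ ≤ C₁ * (1 + ‖l‖) ^ (-(m : ℝ)) :=
    (mul_le_mul_of_nonneg_right (by simp) (norm_nonneg _)).trans (hC₁ z.2 l)
  have e3 : ‖SchwartzMap.fderivCLM ℝ _ _ K (chord z.2 l)‖ ≤ C₂ * (1 + ‖l‖) ^ (-(m : ℝ)) :=
    le_trans (le_mul_of_one_le_left (norm_nonneg _) (by simp)) (hC₂ z.2 l)
  have e4 : ‖integrandDeriv ħ K z l‖ ≤ ‖K (chord z.2 l)‖ * (‖-Complex.I / (ħ : ℂ)‖ * ‖l‖) +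
      ‖SchwartzMap.fderivCLM ℝ _ _ K (chord z.2 l)‖ * ‖T‖ := by
    refine (norm_add_le _ _).trans (add_le_add ?_ ?_)
    · rw [norm_smul, norm_smul, norm_smul, norm_phase, one_mul]
      gcongr
    · rw [norm_smul, norm_phase, one_mul]
      exact ContinuousLinearMap.opNorm_comp_le _ _
  refine e4.trans ?_
  have e5 := mul_le_mul_of_nonneg_left e2 (norm_nonneg (-Complex.I / (ħ : ℂ)))
  have e6 := mul_le_mul_of_nonneg_right e3 (norm_nonneg T)
  linarith

/-- On a chord `l = x' - x''`, so the factor `l` from the phase becomes multiplication of the kernel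
by a linear form. -/
theorem integrandDeriv_apply (K : Ker N) (z v : Phase N) (l : Conf N) :
    integrandDeriv ħ K z l v = chordCLM z.2 (phaseDeriv ħ v K) l * phase ħ z.1 l := by
  have e : (chord z.2 l).1 - (chord z.2 l).2 = l := by
    ext i
    simp [chord]
    ring
  have h1 : integrandDeriv ħ K z l v = K (chord z.2 l) * (phase ħ z.1 l * ((-Complex.I / (ħ : ℂ)) *
      ((inner ℝ l v.1 : ℝ) : ℂ))) + phase ħ z.1 l * fderiv ℝ K (chord z.2 l) (v.2, v.2) := rfl
  have h2 : chordCLM z.2 (phaseDeriv ħ v K) l = derivAlong (v.2, v.2) K (chord z.2 l) +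
      (-Complex.I / (ħ : ℂ)) * mulForm ((innerSL ℝ v.1).comp
      (ContinuousLinearMap.fst ℝ (Conf N) (Conf N) - ContinuousLinearMap.snd ℝ _ _)) K
        (chord z.2 l) := rfl
  have h3 : ((innerSL ℝ v.1).comp (ContinuousLinearMap.fst ℝ (Conf N) (Conf N) -
      ContinuousLinearMap.snd ℝ _ _)) (chord z.2 l) = inner ℝ l v.1 := by
    change inner ℝ v.1 ((chord z.2 l).1 - (chord z.2 l).2) = _
    rw [e, real_inner_comm]
  rw [h1, h2, derivAlong_apply, mulForm_apply, h3]
  ring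

theorem integrable_integrandDeriv (K : Ker N) (z : Phase N) :
    Integrable (integrandDeriv ħ K z) := by
  obtain ⟨C, hC⟩ := norm_integrandDeriv_le ħ K (volume : Measure (Conf N)).integrablePower
  exact ((Measure.integrable_pow_neg_integrablePower
    (volume : Measure (Conf N))).const_mul C).mono'
    (continuous_integrandDeriv ħ K z).aestronglyMeasurable (.of_forall (hC z))

theorem hasFDerivAt_integral_integrand (K : Ker N) (z : Phase N) :
    HasFDerivAt (fun z : Phase N => ∫ l, K (chord z.2 l) * phase ħ z.1 l)
      (∫ l, integrandDeriv ħ K z l) z := by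
  obtain ⟨C, hC⟩ := norm_integrandDeriv_le ħ K (volume : Measure (Conf N)).integrablePower
  have hcont (z : Phase N) : Continuous (fun l => K (chord z.2 l) * phase ħ z.1 l) :=
    (K.continuous.comp (continuous_chord _)).mul (continuous_phase ħ _)
  have hint : Integrable (fun l => K (chord z.2 l) * phase ħ z.1 l) := by
    refine (chordCLM z.2 K).integrable.norm.mono' (hcont z).aestronglyMeasurable
      (.of_forall fun l => ?_)
    rw [norm_mul, norm_phase, mul_one, chordCLM_apply]
  exact hasFDerivAt_integral_of_dominated_of_fderiv_le
    Filter.univ_mem (.of_forall fun z => (hcont z).aestronglyMeasurable) hint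
    (continuous_integrandDeriv ħ K z).aestronglyMeasurable (.of_forall fun l z _ => hC z l)
    ((Measure.integrable_pow_neg_integrablePower (volume : Measure (Conf N))).const_mul C)
    (.of_forall fun l z _ => hasFDerivAt_integrand ħ K z l)

theorem hasFDerivAt_wigner (K : Ker N) (z : Phase N) :
    HasFDerivAt (wigner ħ K)
      ((((2 * Real.pi * ħ) ^ N : ℝ) : ℂ)⁻¹ • ∫ l, integrandDeriv ħ K z l) z :=
  (hasFDerivAt_integral_integrand ħ K z).const_mul _

theorem fderiv_wigner (K : Ker N) (z v : Phase N) :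
    fderiv ℝ (wigner ħ K) z v = wigner ħ (phaseDeriv ħ v K) z := by
  rw [(hasFDerivAt_wigner ħ K z).fderiv, smul_apply,
    ContinuousLinearMap.integral_apply (integrable_integrandDeriv ħ K z), wigner_apply, smul_eq_mul]
  simp only [integrandDeriv_apply]

/-- Directional derivatives of a Wigner transform are Wigner transforms of other Schwartz kernels,
so the induction runs over all kernels at once. -/
theorem contDiff_wigner (K : Ker N) : ContDiff ℝ ∞ (wigner ħ K) := by
  refine contDiff_infty.2 fun n => ?_
  induction n generalizing K with
  | zero =>
    exact contDiff_zero.2 (continuous_iff_continuousAt.2 fun z =>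
      (hasFDerivAt_wigner ħ K z).continuousAt)
  | succ n ih =>
    push_cast
    refine contDiff_succ_iff_fderiv_apply.2 ⟨fun z =>
      (hasFDerivAt_wigner ħ K z).differentiableAt, by simp, fun v => ?_⟩
    simp only [fderiv_wigner]
    exact ih _

/-! ### Coordinates and the Wigner transform -/

/-- The phase-space coordinates `pₙ` and `xₙ`. -/
def coordFun (i : Idx N) (z : Phase N) : ℂ :=
  Sum.elim (fun n => ((z.1 n : ℝ) : ℂ)) (fun n => ((z.2 n : ℝ) : ℂ)) i

/-- The Hamiltonian vector fields `-∂/∂xₙ` and `∂/∂pₙ` of the coordinates `pₙ` and `xₙ`. -/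
def hamDeriv (i : Idx N) (f : Phase N → ℂ) : Phase N → ℂ :=
  Sum.elim (fun n => -dX n f) (fun n => dP n f) i

theorem dX_wigner (n : Fin N) (K : Ker N) :
    dX n (wigner ħ K) = wigner ħ (derivAlong (unitVec n, unitVec n) K) := by
  ext z
  rw [dX, fderiv_wigner]
  congr 2
  ext q
  simp [phaseDeriv]

theorem dP_wigner (n : Fin N) (K : Ker N) :
    dP n (wigner ħ K) = wigner ħ ((-Complex.I / (ħ : ℂ)) •
      (genLeft ħ (Sum.inr n) K - genRight ħ (Sum.inr n) K)) := by
  ext z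
  rw [dP, fderiv_wigner]
  congr 2
  ext q
  have h : inner ℝ (unitVec n) (q.1 - q.2) = q.1 n - q.2 n := by
    simp [unitVec, EuclideanSpace.inner_single_left]
  have h0 : ((0, 0) : Conf N × Conf N) = 0 := rfl
  simp only [phaseDeriv, LinearMap.add_apply, LinearMap.smul_apply, add_apply, smul_apply,
    derivAlong_apply, mulForm_apply, ContinuousLinearMap.comp_apply, innerSL_apply_apply,
    ContinuousLinearMap.coe_fst', ContinuousLinearMap.coe_snd', h,
    genLeft, genRight, Sum.elim_inr, sub_apply, smul_eq_mul, coord_apply, h0, map_zero]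
  push_cast
  ring

theorem coordFun_inr_mul_wigner (n : Fin N) (K : Ker N) :
    coordFun (Sum.inr n) * wigner ħ K =
      wigner ħ ((1 / 2 : ℂ) • (genLeft ħ (Sum.inr n) K + genRight ħ (Sum.inr n) K)) := by
  ext z
  rw [Pi.mul_apply, wigner_apply, wigner_apply, mul_left_comm, ← integral_const_mul]
  congr 1
  refine integral_congr_ae (.of_forall fun l => ?_)
  simp [coordFun, genLeft, genRight, chord]
  ring

/-- The Fourier transform turns the derivative along the chord into multiplication by the momentum;
varying `l` moves the two end points oppositely, by half each. -/
theorem coordFun_inl_mul_wigner (hħ : ħ ≠ 0) (n : Fin N) (K : Ker N) :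
    coordFun (Sum.inl n) * wigner ħ K =
      wigner ħ ((-Complex.I * (ħ : ℂ) / 2) • derivAlong (unitVec n, -unitVec n) K) := by
  ext z
  have h : wigner ħ ((1 / 2 : ℂ) • derivAlong (unitVec n, -unitVec n) K) z =
      Complex.I / ħ * (coordFun (Sum.inl n) z * wigner ħ K z) := by
    rw [wigner_eq_fourier, wigner_eq_fourier]
    have h1 : chordCLM z.2 ((1 / 2 : ℂ) • derivAlong (unitVec n, -unitVec n) K) =
        LineDeriv.lineDerivOp (unitVec n) (chordCLM z.2 K) := by
      ext l
      rw [← derivAlong_chordCLM]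
      rfl
    rw [h1, SchwartzMap.fourier_lineDerivOp_eq, smul_apply, SchwartzMap.smulLeftCLM_apply_apply
      (by fun_prop)]
    have h2 : inner ℝ ((2 * Real.pi * ħ)⁻¹ • z.1) (unitVec n) = (2 * Real.pi * ħ)⁻¹ * z.1 n := by
      simp [unitVec, EuclideanSpace.inner_single_right]
    rw [h2]
    simp [coordFun]
    field_simp
  rw [wigner_smul] at h ⊢
  simp only [Pi.smul_apply, smul_eq_mul, Pi.mul_apply] at h ⊢
  have hħ' : (ħ : ℂ) ≠ 0 := by exact_mod_cast hħ
  have h3 : (-Complex.I * ħ) * (1 / 2 * wigner ħ (derivAlong (unitVec n, -unitVec n) K) z) =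
    coordFun (Sum.inl n) z * wigner ħ K z := by
    rw [h]
    field_simp
    simp
  rw [← h3]
  ring

/-- The Bopp shift. A position acts at the end point `x + l/2`, where `l/2` becomes a momentum
derivative; a momentum differentiates that end point only. -/
theorem wigner_genLeft (hħ : ħ ≠ 0) (i : Idx N) (K : Ker N) :
    wigner ħ (genLeft ħ i K) =
      coordFun i * wigner ħ K + (Complex.I * ħ / 2) • hamDeriv i (wigner ħ K) := by
  have hħ' : (ħ : ℂ) ≠ 0 := by exact_mod_cast hħ
  rcases i with n | n
  · rw [coordFun_inl_mul_wigner ħ hħ, hamDeriv, Sum.elim_inl, dX_wigner,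
      ← neg_one_smul ℂ (wigner ħ _), ← wigner_smul, ← wigner_smul, ← wigner_add]
    congr 2
    -- The antisymmetric direction varies the chord and gives the factor `p`; the symmetric one
    -- moves the midpoint and gives the derivative in `x`.
    have h : ((unitVec n, 0) : Conf N × Conf N) =
      (1 / 2 : ℝ) • ((unitVec n, -unitVec n) + (unitVec n, unitVec n)) := by
      ext
      · simp
        ring
      · simp
    rw [genLeft, Sum.elim_inl, h, derivAlong_smul_left, derivAlong_add_left]
    ext q
    simp only [LinearMap.smul_apply, LinearMap.add_apply, smul_apply, add_apply, smul_eq_mul]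
    push_cast
    ring
  · rw [coordFun_inr_mul_wigner, hamDeriv, Sum.elim_inr, dP_wigner, ← wigner_smul, ← wigner_add]
    congr 2
    ext q
    simp only [smul_apply, add_apply, smul_eq_mul, sub_apply]
    field_simp
    simp
    ring

theorem wigner_genRight (hħ : ħ ≠ 0) (i : Idx N) (K : Ker N) :
    wigner ħ (genRight ħ i K) =
      coordFun i * wigner ħ K - (Complex.I * ħ / 2) • hamDeriv i (wigner ħ K) := by
  have hħ' : (ħ : ℂ) ≠ 0 := by exact_mod_cast hħ
  rcases i with n | n
  · rw [coordFun_inl_mul_wigner ħ hħ, hamDeriv, Sum.elim_inl, dX_wigner,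
      ← neg_one_smul ℂ (wigner ħ _), ← wigner_smul, ← wigner_smul, ← wigner_sub]
    congr 2
    have h : ((0, unitVec n) : Conf N × Conf N) =
      (1 / 2 : ℝ) • ((-1 : ℝ) • (unitVec n, -unitVec n) + (unitVec n, unitVec n)) := by
      ext
      · simp
      · simp
        ring
    rw [genRight, Sum.elim_inl, h, derivAlong_smul_left, derivAlong_add_left, derivAlong_smul_left]
    ext q
    simp only [LinearMap.smul_apply, LinearMap.add_apply, smul_apply, add_apply, smul_eq_mul,
      sub_apply]
    push_cast
    ring
  · rw [coordFun_inr_mul_wigner, hamDeriv, Sum.elim_inr, dP_wigner, ← wigner_smul, ← wigner_sub]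
    congr 2
    ext q
    simp only [smul_apply, add_apply, smul_eq_mul, sub_apply]
    field_simp
    simp
    ring

/-- The derivative terms of the two Bopp shifts cancel in the mean. -/
theorem coordFun_mul_wigner (hħ : ħ ≠ 0) (i : Idx N) (K : Ker N) :
    coordFun i * wigner ħ K = wigner ħ ((1 / 2 : ℂ) • (genLeft ħ i K + genRight ħ i K)) := by
  rw [wigner_smul, wigner_add, wigner_genLeft ħ hħ, wigner_genRight ħ hħ]
  ext z
  simp
  ring

/-! ### Integrability and the trace -/

/-- Polynomial weights stay within the class of Wigner transforms. As these are all bounded,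
iterating this gives arbitrary polynomial decay. -/
theorem exists_wigner_eq_normSq_mul (hħ : ħ ≠ 0) (K : Ker N) :
    ∃ K' : Ker N, ∀ z : Phase N,
      wigner ħ K' z = ((1 + ‖z.1‖ ^ 2 + ‖z.2‖ ^ 2 : ℝ) : ℂ) * wigner ħ K z := by
  have h (i : Idx N) : ∃ K' : Ker N, wigner ħ K' = coordFun i * (coordFun i * wigner ħ K) := by
    rw [coordFun_mul_wigner ħ hħ, coordFun_mul_wigner ħ hħ]
    exact ⟨_, rfl⟩
  choose k hk using h
  refine ⟨K + ∑ i, k i, fun z => ?_⟩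
  rw [wigner_add, wigner_sum]
  simp only [Pi.add_apply, Finset.sum_apply, hk, Fintype.sum_sum_type, coordFun, Sum.elim_inl,
    Sum.elim_inr, Pi.mul_apply, EuclideanSpace.norm_sq_eq, Real.norm_eq_abs, sq_abs]
  push_cast
  simp only [add_mul, Finset.sum_mul, one_mul, sq, mul_assoc, add_assoc]

theorem integrable_wigner (hħ : ħ ≠ 0) (K : Ker N) : Integrable (wigner ħ K) := by
  set m := (volume : Measure (Conf N × Conf N)).integrablePower with hm
  have h (m : ℕ) : ∃ K' : Ker N, ∀ z : Phase N,
      wigner ħ K' z = ((1 + ‖z.1‖ ^ 2 + ‖z.2‖ ^ 2 : ℝ) : ℂ) ^ m * wigner ħ K z := by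
    induction m with
    | zero => exact ⟨K, by simp⟩
    | succ m ih =>
      obtain ⟨K', hK'⟩ := ih
      obtain ⟨K'', hK''⟩ := exists_wigner_eq_normSq_mul ħ hħ K'
      exact ⟨K'', fun z => by rw [hK'', hK', pow_succ']; ring⟩
  obtain ⟨K', hK'⟩ := h m
  obtain ⟨C, hC⟩ := exists_norm_wigner_le ħ K'
  refine ((Measure.integrable_pow_neg_integrablePower
    (volume : Measure (Conf N × Conf N))).const_mul (2 ^ m * C)).mono'
    (contDiff_wigner ħ K).continuous.aestronglyMeasurable (.of_forall fun z => ?_)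
  rw [← hm, Real.rpow_neg (by positivity), Real.rpow_natCast, ← div_eq_mul_inv,
    le_div_iff₀ (by positivity)]
  have h1 : 1 + ‖z‖ ≤ 2 * (1 + ‖z.1‖ ^ 2 + ‖z.2‖ ^ 2) := by
    rcases max_cases ‖z.1‖ ‖z.2‖ with h | h <;> rw [Prod.norm_def, h.1] <;>
      nlinarith [sq_nonneg (‖z.1‖ - 1), sq_nonneg (‖z.2‖ - 1)]
  have h2 := hC z
  rw [hK', norm_mul, norm_pow, Complex.norm_real, Real.norm_of_nonneg (by positivity)] at h2
  calc ‖wigner ħ K z‖ * (1 + ‖z‖) ^ m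
      ≤ ‖wigner ħ K z‖ * (2 * (1 + ‖z.1‖ ^ 2 + ‖z.2‖ ^ 2)) ^ m := by gcongr
    _ = 2 ^ m * ((1 + ‖z.1‖ ^ 2 + ‖z.2‖ ^ 2) ^ m * ‖wigner ħ K z‖) := by rw [mul_pow]; ring
    _ ≤ _ := by gcongr

/-- Integrating over the momentum first, Fourier inversion at `l = 0` leaves the diagonal value `K
(x, x)`. -/
theorem integral_wigner (hħ : 0 < ħ) (K : Ker N) : ∫ z, wigner ħ K z = kerTrace K := by
  have hi : Integrable (wigner ħ K) ((volume : Measure (Conf N)).prod volume) :=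
    integrable_wigner ħ hħ.ne' K
  rw [kerTrace_apply]
  change ∫ z, wigner ħ K z ∂((volume : Measure (Conf N)).prod volume) = _
  rw [integral_prod_symm _ hi]
  refine integral_congr_ae (.of_forall fun x => ?_)
  simp only [wigner_eq_fourier, integral_const_mul]
  -- The Jacobian `(2πħ)ᴺ` of the rescaled momentum cancels the normalization of the Wigner
  -- function.
  rw [Measure.integral_comp_smul volume (fun w => 𝓕 (chordCLM x K) w)]
  have h0 : ∫ w, 𝓕 (chordCLM x K) w = chordCLM x K 0 := by
    have h1 : 𝓕⁻ (𝓕 (chordCLM x K)) = chordCLM x K := FourierTransform.fourierInv_fourier_eq _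
    have h2 := DFunLike.congr_fun h1 0
    rw [SchwartzMap.fourierInv_coe, Real.fourierInv_eq'] at h2
    simpa using h2
  have hc : chordCLM x K 0 = K (x, x) := by simp [chord]
  have hpos : 0 < 2 * Real.pi * ħ := by positivity
  rw [h0, hc, finrank_euclideanSpace, Fintype.card_fin, inv_pow, inv_inv,
    abs_of_pos (by positivity), Complex.real_smul, inv_mul_cancel_left₀]
  exact_mod_cast (pow_pos hpos N).ne'

end WignerFlow

end

/-! ### The bidifferential operator as an endomorphism of a tensor square. -/

noncomputable section

namespace WignerFlow

variable {N : ℕ}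

open scoped TensorProduct

/-! ### Smooth functions on phase space and bidifferential operators -/

theorem end_neg_mul {M : Type*} [AddCommGroup M] [Module ℂ M] (A B : Module.End ℂ M) :
    -A * B = -(A * B) := rfl

theorem end_mul_neg {M : Type*} [AddCommGroup M] [Module ℂ M] (A B : Module.End ℂ M) :
    A * -B = -(A * B) := LinearMap.ext fun x => map_neg A (B x)

/-- The algebra of smooth complex functions on phase space. -/
def smoothSubalgebra (N : ℕ) : Subalgebra ℂ (Phase N → ℂ) where
  carrier := {f | ContDiff ℝ ∞ f}
  mul_mem' {f g} (hf : ContDiff ℝ ∞ f) (hg : ContDiff ℝ ∞ g) := hf.mul hg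
  add_mem' {f g} (hf : ContDiff ℝ ∞ f) (hg : ContDiff ℝ ∞ g) := hf.add hg
  algebraMap_mem' c := (contDiff_const : ContDiff ℝ ∞ fun _ : Phase N => c)

/-- Smooth complex functions on phase space. -/
def Smooth (N : ℕ) : Type := smoothSubalgebra N

namespace Smooth

instance : CommRing (Smooth N) := inferInstanceAs (CommRing (smoothSubalgebra N))

instance : Algebra ℂ (Smooth N) := inferInstanceAs (Algebra ℂ (smoothSubalgebra N))

/-- The underlying function, as an algebra homomorphism. -/
def toFun : Smooth N →ₐ[ℂ] (Phase N → ℂ) := (smoothSubalgebra N).val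

theorem contDiff (f : Smooth N) : ContDiff ℝ ∞ (toFun f) := f.2

@[ext]
theorem ext {f g : Smooth N} (h : ∀ z, toFun f z = toFun g z) : f = g := Subtype.ext (funext h)

/-- A smooth function as an element of `Smooth N`. -/
def mk (f : Phase N → ℂ) (hf : ContDiff ℝ ∞ f) : Smooth N := ⟨f, hf⟩

@[simp]
theorem toFun_mk (f : Phase N → ℂ) (hf : ContDiff ℝ ∞ f) : toFun (mk f hf) = f := rfl

theorem differentiableAt (f : Smooth N) (z : Phase N) : DifferentiableAt ℝ (toFun f) z :=
  f.contDiff.differentiable (by simp) z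

/-- The derivative of smooth functions in the direction `v`. -/
def deriv (v : Phase N) : Module.End ℂ (Smooth N) where
  toFun f := mk (fun z => fderiv ℝ (toFun f) z v)
    ((f.contDiff.fderiv_right (m := ∞) (by simp)).clm_apply contDiff_const)
  map_add' f g := by
    ext z
    simp only [toFun_mk, map_add, Pi.add_apply]
    rw [fderiv_add (f.differentiableAt z) (g.differentiableAt z)]
    rfl
  map_smul' c f := by
    ext z
    simp only [toFun_mk, map_smul, Pi.smul_apply, RingHom.id_apply]
    rw [fderiv_const_smul (f.differentiableAt z)]
    rfl

theorem deriv_apply (v : Phase N) (f : Smooth N) (z : Phase N) :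
    toFun (deriv v f) z = fderiv ℝ (toFun f) z v := rfl

theorem deriv_mul (v : Phase N) (f g : Smooth N) :
    deriv v (f * g) = deriv v f * g + f * deriv v g := by
  ext z
  simp only [deriv_apply, map_add, map_mul, Pi.add_apply, Pi.mul_apply]
  rw [fderiv_mul (f.differentiableAt z) (g.differentiableAt z)]
  simp
  ring

theorem deriv_algebraMap (v : Phase N) (c : ℂ) : deriv v (algebraMap ℂ (Smooth N) c) = 0 := by
  ext z
  rw [deriv_apply, AlgHom.commutes]
  change fderiv ℝ (fun _ : Phase N => c) z v = 0
  simp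

theorem deriv_comm (v w : Phase N) : deriv v * deriv w = deriv w * deriv v := by
  ext f z
  have h2 : ContDiff ℝ 2 (toFun f) := contDiff_infty.1 f.contDiff 2
  have h (v w : Phase N) : toFun (deriv v (deriv w f)) z = fderiv ℝ (fderiv ℝ (toFun f)) z v w := by
    have h1 : DifferentiableAt ℝ (fderiv ℝ (toFun f)) z :=
      (h2.fderiv_right (m := 1) (by norm_num)).differentiable (by norm_num) z
    rw [deriv_apply]
    change fderiv ℝ (fun z => fderiv ℝ (toFun f) z w) z v = _
    rw [fderiv_clm_apply h1 (by fun_prop)]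
    simp
  have h3 : IsSymmSndFDerivAt ℝ (toFun f) z := h2.contDiffAt.isSymmSndFDerivAt (by simp)
  rw [Module.End.mul_apply, Module.End.mul_apply, h, h, h3.eq]

/-- The direction of the coordinate `pₙ` or `xₙ`. -/
def dir : Idx N → Phase N := Sum.elim (fun n => (unitVec n, 0)) (fun n => (0, unitVec n))

/-- The partial derivative with respect to the coordinate `pₙ` or `xₙ`. -/
def partialDeriv (i : Idx N) : Module.End ℂ (Smooth N) := deriv (dir i)

/-- The Hamiltonian vector field of the coordinate `pₙ` or `xₙ`. -/
def ham : Idx N → Module.End ℂ (Smooth N) :=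
  Sum.elim (fun n => -partialDeriv (Sum.inr n)) (fun n => partialDeriv (Sum.inl n))

theorem partialDeriv_comm (i j : Idx N) :
    partialDeriv i * partialDeriv j = partialDeriv j * partialDeriv i := deriv_comm _ _

theorem ham_partialDeriv_comm (i j : Idx N) :
    ham i * partialDeriv j = partialDeriv j * ham i := by
  rcases i with n | n
  · change -partialDeriv _ * _ = _ * -partialDeriv _
    rw [end_neg_mul, end_mul_neg, partialDeriv_comm]
  · exact partialDeriv_comm _ _

theorem contDiff_coordFun (i : Idx N) : ContDiff ℝ ∞ (coordFun i) := by
  rcases i with n | n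
  · exact (Complex.ofRealCLM.comp ((coord n).comp
      (ContinuousLinearMap.fst ℝ (Conf N) (Conf N)))).contDiff
  · exact (Complex.ofRealCLM.comp ((coord n).comp
      (ContinuousLinearMap.snd ℝ (Conf N) (Conf N)))).contDiff

/-- The coordinates `pₙ`, `xₙ` as smooth functions. -/
def coordinate (i : Idx N) : Smooth N := mk (coordFun i) (contDiff_coordFun i)

theorem partialDeriv_coordinate (i j : Idx N) :
    partialDeriv i (coordinate j) = if i = j then 1 else 0 := by
  have key (L : Phase N →L[ℝ] ℝ) (h : ∀ z, coordFun j z = ((L z : ℝ) : ℂ)) :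
      ∀ z, toFun (partialDeriv i (coordinate j)) z = ((L (dir i) : ℝ) : ℂ) := by
    intro z
    change fderiv ℝ (coordFun j) z (dir i) = _
    rw [show coordFun j = Complex.ofRealCLM.comp L from funext h, ContinuousLinearMap.fderiv]
    rfl
  ext z
  rcases j with n | n
  · rw [key ((coord n).comp (ContinuousLinearMap.fst ℝ _ _))
      (fun z => rfl)]
    rcases i with m | m
    · by_cases h : m = n
      · subst h
        simp [dir, unitVec]
      · simp [dir, unitVec, h, Ne.symm h]
    · simp [dir]
  · rw [key ((coord n).comp (ContinuousLinearMap.snd ℝ _ _))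
      (fun z => rfl)]
    rcases i with m | m
    · simp [dir]
    · by_cases h : m = n
      · subst h
        simp [dir, unitVec]
      · simp [dir, unitVec, h, Ne.symm h]

/-- Multiplication by a coordinate. -/
abbrev mulCoord (i : Idx N) : Module.End ℂ (Smooth N) := LinearMap.mulLeft ℂ (coordinate i)

theorem partialDeriv_mulCoord (i j : Idx N) :
    partialDeriv i * mulCoord j = mulCoord j * partialDeriv i + if i = j then 1 else 0 := by
  ext1 f
  simp only [Module.End.mul_apply, LinearMap.mulLeft_apply, LinearMap.add_apply]
  rw [partialDeriv, deriv_mul, ← partialDeriv, partialDeriv_coordinate]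
  split_ifs <;> simp [add_comm]

/-- Sums of products of functions of two phase-space points. -/
abbrev Two (N : ℕ) : Type := Smooth N ⊗[ℂ] Smooth N

/-- An operator acting on the left factor. -/
abbrev onLeft (A : Module.End ℂ (Smooth N)) : Module.End ℂ (Two N) := A.rTensor (Smooth N)

/-- An operator acting on the right factor. -/
abbrev onRight (A : Module.End ℂ (Smooth N)) : Module.End ℂ (Two N) := A.lTensor (Smooth N)

instance : AddCommGroup (Two N) := TensorProduct.addCommGroup

instance : Ring (Module.End ℂ (Two N)) := Module.End.instRing

theorem onLeft_mul (A B : Module.End ℂ (Smooth N)) : onLeft (A * B) = onLeft A * onLeft B :=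
  LinearMap.rTensor_mul ..

theorem onRight_mul (A B : Module.End ℂ (Smooth N)) : onRight (A * B) = onRight A * onRight B :=
  LinearMap.lTensor_mul ..

theorem onLeft_neg (A : Module.End ℂ (Smooth N)) : onLeft (-A) = -onLeft A :=
  LinearMap.rTensor_neg ..

theorem onRight_neg (A : Module.End ℂ (Smooth N)) : onRight (-A) = -onRight A :=
  LinearMap.lTensor_neg ..

theorem onLeft_onRight_comm (A B : Module.End ℂ (Smooth N)) :
    onLeft A * onRight B = onRight B * onLeft A := by
  rw [Module.End.mul_eq_comp, Module.End.mul_eq_comp, LinearMap.lTensor_comp_rTensor,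
    LinearMap.rTensor_comp_lTensor]

/-- The bidifferential operator `∂ₓ(left)·∂ₚ(right) - ∂ₚ(left)·∂ₓ(right)`. -/
def poisson (N : ℕ) : Module.End ℂ (Two N) :=
  ∑ i, onLeft (partialDeriv i) * onRight (ham i)

/-- Antisymmetry of the Poisson structure: the Hamiltonian fields may be placed on either factor at
the cost of a sign. -/
theorem poisson_eq : poisson N = -∑ i, onLeft (ham i) * onRight (partialDeriv i) := by
  rw [poisson, Fintype.sum_sum_type, Fintype.sum_sum_type, neg_add, add_comm]
  simp only [← Finset.sum_neg_distrib]
  congr 1 <;> refine Finset.sum_congr rfl fun n _ => ?_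
  · change _ = -(onLeft (-partialDeriv _) * _)
    rw [onLeft_neg, end_neg_mul, neg_neg]
    rfl
  · change _ * onRight (-partialDeriv _) = _
    rw [onRight_neg, end_mul_neg]
    rfl

theorem commute_poisson_onLeft_partialDeriv (i : Idx N) :
    poisson N * onLeft (partialDeriv i) = onLeft (partialDeriv i) * poisson N := by
  rw [poisson, Finset.sum_mul, Finset.mul_sum]
  refine Finset.sum_congr rfl fun j _ => ?_
  rw [mul_assoc, ← onLeft_onRight_comm, ← mul_assoc, ← mul_assoc, ← onLeft_mul, ← onLeft_mul,
    partialDeriv_comm]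

theorem commute_poisson_onRight_partialDeriv (i : Idx N) :
    poisson N * onRight (partialDeriv i) = onRight (partialDeriv i) * poisson N := by
  rw [poisson, Finset.sum_mul, Finset.mul_sum]
  refine Finset.sum_congr rfl fun j _ => ?_
  rw [mul_assoc, ← onRight_mul, ← mul_assoc, ← onLeft_onRight_comm, mul_assoc, ← onRight_mul,
    ham_partialDeriv_comm]

theorem commute_poisson_onLeft_ham (i : Idx N) :
    poisson N * onLeft (ham i) = onLeft (ham i) * poisson N := by
  rcases i with n | n
  · change _ * onLeft (-partialDeriv _) = onLeft (-partialDeriv _) * _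
    rw [onLeft_neg, end_neg_mul, end_mul_neg, commute_poisson_onLeft_partialDeriv]
  · exact commute_poisson_onLeft_partialDeriv _

theorem commute_poisson_onRight_ham (i : Idx N) :
    poisson N * onRight (ham i) = onRight (ham i) * poisson N := by
  rcases i with n | n
  · change _ * onRight (-partialDeriv _) = onRight (-partialDeriv _) * _
    rw [onRight_neg, end_neg_mul, end_mul_neg, commute_poisson_onRight_partialDeriv]
  · exact commute_poisson_onRight_partialDeriv _

/-- `Λ` is of first order in the left derivatives, so its commutator with a left coordinate retains
only the partner of `∂ⱼ`. That partner again commutes with `Λ`. -/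
theorem poisson_onLeft_mulCoord (j : Idx N) :
    poisson N * onLeft (mulCoord j) = onLeft (mulCoord j) * poisson N + onRight (ham j) := by
  have h (i : Idx N) : onLeft (partialDeriv i) * onRight (ham i) * onLeft (mulCoord j) =
      onLeft (mulCoord j) * (onLeft (partialDeriv i) * onRight (ham i)) +
        if i = j then onRight (ham i) else 0 := by
    rw [mul_assoc, ← onLeft_onRight_comm, ← mul_assoc, ← onLeft_mul, partialDeriv_mulCoord,
      onLeft, LinearMap.rTensor_add, add_mul, ← onLeft, onLeft_mul, mul_assoc]
    split_ifs
    · rw [Module.End.one_eq_id, LinearMap.rTensor_id, ← Module.End.one_eq_id, one_mul]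
    · simp
  rw [poisson, Finset.sum_mul, Finset.mul_sum, Finset.sum_congr rfl fun i _ => h i,
    Finset.sum_add_distrib, Finset.sum_ite_eq' Finset.univ j, if_pos (Finset.mem_univ j)]

theorem poisson_onRight_mulCoord (j : Idx N) :
    poisson N * onRight (mulCoord j) = onRight (mulCoord j) * poisson N - onLeft (ham j) := by
  have h (i : Idx N) : onLeft (ham i) * onRight (partialDeriv i) * onRight (mulCoord j) =
      onRight (mulCoord j) * (onLeft (ham i) * onRight (partialDeriv i)) +
        if i = j then onLeft (ham i) else 0 := by
    rw [mul_assoc, ← onRight_mul, partialDeriv_mulCoord, onRight, LinearMap.lTensor_add, mul_add,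
      ← onRight, onRight_mul, ← mul_assoc, ← mul_assoc, onLeft_onRight_comm]
    split_ifs
    · rw [Module.End.one_eq_id, LinearMap.lTensor_id, ← Module.End.one_eq_id, mul_one]
    · simp
  rw [poisson_eq, neg_mul, mul_neg, Finset.sum_mul, Finset.mul_sum,
    Finset.sum_congr rfl fun i _ => h i, Finset.sum_add_distrib,
    Finset.sum_ite_eq' Finset.univ j, if_pos (Finset.mem_univ j), neg_add, sub_eq_add_neg]

end Smooth

/-- The commutator with `x` is a derivation, and since `d` commutes with `a` it acts on powers of
`a` like `d` times the formal derivative. -/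
theorem pow_succ_mul_of_commutator {R : Type*} [Ring R] {a x d : R} (h : a * x = x * a + d)
    (hd : a * d = d * a) (l : ℕ) :
    a ^ (l + 1) * x = x * a ^ (l + 1) + (l + 1) • (d * a ^ l) := by
  induction l with
  | zero => simp [h]
  | succ l ih =>
    rw [pow_succ' a (l + 1), mul_assoc, ih, mul_add, ← mul_assoc, h, mul_smul_comm, ← mul_assoc a d,
      hd, mul_assoc d a, ← pow_succ', add_mul, mul_assoc x, ← pow_succ', add_smul (l + 1) 1, one_smul]
    abel

end WignerFlow

end

/-! ### Two-point functions, termination of the series, star and sinc products. -/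

noncomputable section

namespace WignerFlow

variable {N : ℕ}

open scoped TensorProduct

namespace Smooth

/-! ### Evaluation of two-point functions -/

/-- Evaluation of the right factor. -/
def evalRight (w : Phase N) : Two N →ₗ[ℂ] Smooth N :=
  TensorProduct.lift ((LinearMap.lsmul ℂ (Smooth N)).flip.compr₂
    (LinearMap.id) |>.compl₂ ((LinearMap.proj w : (Phase N → ℂ) →ₗ[ℂ] ℂ) ∘ₗ toFun.toLinearMap))

/-- Evaluation of the left factor. -/
def evalLeft (z : Phase N) : Two N →ₗ[ℂ] Smooth N :=
  evalRight z ∘ₗ (TensorProduct.comm ℂ (Smooth N) (Smooth N)).toLinearMap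

theorem evalRight_tmul (w : Phase N) (f g : Smooth N) :
    evalRight w (f ⊗ₜ g) = toFun g w • f := rfl

theorem evalLeft_tmul (z : Phase N) (f g : Smooth N) :
    evalLeft z (f ⊗ₜ g) = toFun f z • g := rfl

/-- The two-point function of an element of the tensor square. -/
def twoFun (τ : Two N) : Phase N → Phase N → ℂ := fun z w => toFun (evalRight w τ) z

theorem twoFun_eq_evalLeft (τ : Two N) (z w : Phase N) :
    twoFun τ z w = toFun (evalLeft z τ) w := by
  unfold twoFun
  induction τ using TensorProduct.induction_on with
  | zero => simp
  | tmul f g => simp [evalRight_tmul, evalLeft_tmul, mul_comm]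
  | add a b ha hb => simp only [map_add, Pi.add_apply, ha, hb]

theorem twoFun_tmul (f g : Smooth N) : twoFun (f ⊗ₜ g) = fun z w => toFun f z * toFun g w := by
  funext z w
  simp [twoFun, evalRight_tmul, mul_comm]

/-- Multiplication of the two factors. -/
def merge (N : ℕ) : Two N →ₗ[ℂ] Smooth N := LinearMap.mul' ℂ (Smooth N)

theorem merge_tmul (f g : Smooth N) : merge N (f ⊗ₜ g) = f * g := rfl

theorem twoFun_diag (τ : Two N) (z : Phase N) : twoFun τ z z = toFun (merge N τ) z := by
  unfold twoFun
  induction τ using TensorProduct.induction_on with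
  | zero => simp
  | tmul f g => simp [evalRight_tmul, merge_tmul, mul_comm]
  | add a b ha hb => simp only [map_add, Pi.add_apply, ha, hb]

theorem evalRight_onLeft (w : Phase N) (A : Module.End ℂ (Smooth N)) (τ : Two N) :
    evalRight w (onLeft A τ) = A (evalRight w τ) := by
  induction τ using TensorProduct.induction_on with
  | zero => simp
  | tmul f g => simp [evalRight_tmul]
  | add a b ha hb => simp only [map_add, ha, hb]

theorem evalLeft_onRight (z : Phase N) (A : Module.End ℂ (Smooth N)) (τ : Two N) :
    evalLeft z (onRight A τ) = A (evalLeft z τ) := by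
  induction τ using TensorProduct.induction_on with
  | zero => simp
  | tmul f g => simp [evalLeft_tmul]
  | add a b ha hb => simp only [map_add, ha, hb]

theorem fderiv_twoFun_left (τ : Two N) (i : Idx N) (z w : Phase N) :
    fderiv ℝ (fun z => twoFun τ z w) z (dir i) = twoFun (onLeft (partialDeriv i) τ) z w := by
  unfold twoFun
  rw [evalRight_onLeft]
  rfl

theorem fderiv_twoFun_right (τ : Two N) (i : Idx N) (z w : Phase N) :
    fderiv ℝ (twoFun τ z) w (dir i) = twoFun (onRight (partialDeriv i) τ) z w := by
  rw [twoFun_eq_evalLeft, evalLeft_onRight,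
    show twoFun τ z = toFun (evalLeft z τ) from funext fun w => twoFun_eq_evalLeft τ z w]
  rfl

theorem twoFun_sum {ι : Type*} (s : Finset ι) (τ : ι → Two N) (z w : Phase N) :
    twoFun (∑ i ∈ s, τ i) z w = ∑ i ∈ s, twoFun (τ i) z w := by
  simp [twoFun]

theorem poisson_eq_sum : poisson N = ∑ n : Fin N,
    (onLeft (partialDeriv (Sum.inr n)) * onRight (partialDeriv (Sum.inl n)) -
      onLeft (partialDeriv (Sum.inl n)) * onRight (partialDeriv (Sum.inr n))) := by
  rw [poisson, Fintype.sum_sum_type, Finset.sum_sub_distrib, add_comm, sub_eq_add_neg,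
    ← Finset.sum_neg_distrib]
  congr 1
  refine Finset.sum_congr rfl fun n _ => ?_
  change _ * onRight (-partialDeriv _) = _
  rw [onRight_neg, end_mul_neg]

/-- The bridge to the tensor square: with one argument frozen by evaluation, a derivative in the
other argument is an operator on one tensor factor. -/
theorem biDiff_twoFun (τ : Two N) : biDiff (twoFun τ) = twoFun (poisson N τ) := by
  funext z w
  rw [poisson_eq_sum, LinearMap.sum_apply, twoFun_sum]
  refine Finset.sum_congr rfl fun n _ => ?_
  have h1 : dX n (fun z' => dP n (twoFun τ z') w) z =
      twoFun (onLeft (partialDeriv (Sum.inr n)) (onRight (partialDeriv (Sum.inl n)) τ)) z w := by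
    rw [← fderiv_twoFun_left]
    congr 2
    funext z'
    exact fderiv_twoFun_right τ (Sum.inl n) z' w
  have h2 : dP n (fun z' => dX n (twoFun τ z') w) z =
      twoFun (onLeft (partialDeriv (Sum.inl n)) (onRight (partialDeriv (Sum.inr n)) τ)) z w := by
    rw [← fderiv_twoFun_left]
    congr 2
    funext z'
    exact fderiv_twoFun_right τ (Sum.inr n) z' w
  rw [h1, h2, LinearMap.sub_apply]
  simp only [twoFun, map_sub, Pi.sub_apply, Module.End.mul_apply]

theorem biDiffPow_toFun (l : ℕ) (f g : Smooth N) :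
    biDiffPow l (toFun f) (toFun g) = toFun (merge N ((poisson N ^ l) (f ⊗ₜ g))) := by
  have h (τ : Two N) : biDiff^[l] (twoFun τ) = twoFun ((poisson N ^ l) τ) := by
    induction l generalizing τ with
    | zero => rfl
    | succ l ih => rw [Function.iterate_succ_apply, biDiff_twoFun, ih, pow_succ, Module.End.mul_apply]
  funext z
  rw [biDiffPow, ← twoFun_tmul, h, twoFun_diag]

/-! ### Terminating series -/

theorem poisson_pow_eq_zero_of_le {M l : ℕ} (h : M ≤ l) {τ : Two N}
    (hτ : (poisson N ^ M) τ = 0) : (poisson N ^ l) τ = 0 := by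
  obtain ⟨k, rfl⟩ := Nat.exists_eq_add_of_le' h
  rw [pow_add, Module.End.mul_apply, hτ, map_zero]

/-- The bidifferential operator is nilpotent on products with left factor `f`. -/
def FiniteOrder (f : Smooth N) : Prop := ∃ M : ℕ, ∀ g, (poisson N ^ M) (f ⊗ₜ g) = 0

theorem commute_pow_apply {A : Module.End ℂ (Two N)} (h : poisson N * A = A * poisson N) (l : ℕ)
    (τ : Two N) : (poisson N ^ l) (A τ) = A ((poisson N ^ l) τ) := by
  have h1 : Commute (poisson N) A := h
  rw [← Module.End.mul_apply, (h1.pow_left l).eq, Module.End.mul_apply]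

theorem FiniteOrder.partialDeriv {f : Smooth N} (hf : FiniteOrder f) (i : Idx N) :
    FiniteOrder (partialDeriv i f) := by
  obtain ⟨M, hM⟩ := hf
  refine ⟨M, fun g => ?_⟩
  have := commute_pow_apply (commute_poisson_onLeft_partialDeriv i) M (f ⊗ₜ g)
  rw [hM, map_zero] at this
  simpa using this

theorem comm_poisson (τ : Two N) : TensorProduct.comm ℂ _ _ (poisson N τ) =
    -poisson N (TensorProduct.comm ℂ _ _ τ) := by
  induction τ using TensorProduct.induction_on with
  | zero => simp
  | tmul f g =>
    have h1 (f g : Smooth N) : poisson N (f ⊗ₜ g) = ∑ i, partialDeriv i f ⊗ₜ ham i g := by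
      rw [poisson, LinearMap.sum_apply]
      rfl
    have h2 (f g : Smooth N) : poisson N (f ⊗ₜ g) = -∑ i, ham i f ⊗ₜ partialDeriv i g := by
      rw [poisson_eq, LinearMap.neg_apply, LinearMap.sum_apply]
      rfl
    rw [h1, TensorProduct.comm_tmul, h2, neg_neg, map_sum]
    rfl
  | add a b ha hb => simp only [map_add, ha, hb, neg_add]

theorem comm_poisson_pow (l : ℕ) (τ : Two N) : TensorProduct.comm ℂ _ _ ((poisson N ^ l) τ) =
    (-1 : ℂ) ^ l • (poisson N ^ l) (TensorProduct.comm ℂ _ _ τ) := by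
  induction l generalizing τ with
  | zero => simp
  | succ l ih =>
    rw [pow_succ, Module.End.mul_apply, ih, comm_poisson, map_neg, Module.End.mul_apply, pow_succ,
      mul_smul, neg_one_smul]

/-- Exchanging the factors replaces `Λ` by `-Λ`. -/
theorem FiniteOrder.right {f : Smooth N} (hf : FiniteOrder f) :
    ∃ M : ℕ, ∀ g, (poisson N ^ M) (g ⊗ₜ f) = 0 := by
  obtain ⟨M, hM⟩ := hf
  refine ⟨M, fun g => ?_⟩
  have h := comm_poisson_pow M (f ⊗ₜ g)
  rw [hM, map_zero, TensorProduct.comm_tmul] at h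
  exact (smul_eq_zero.1 h.symm).resolve_left (by simp)

theorem poisson_pow_succ_onLeft_mulCoord (l : ℕ) (i : Idx N) (τ : Two N) :
    (poisson N ^ (l + 1)) (onLeft (mulCoord i) τ) =
      onLeft (mulCoord i) ((poisson N ^ (l + 1)) τ) +
        ((l + 1 : ℕ) : ℂ) • (poisson N ^ l) (onRight (ham i) τ) := by
  have h := pow_succ_mul_of_commutator (poisson_onLeft_mulCoord (N := N) i)
    (commute_poisson_onRight_ham i) l
  have h' := LinearMap.congr_fun h τ
  rw [commute_pow_apply (commute_poisson_onRight_ham i), Nat.cast_smul_eq_nsmul]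
  exact h'

theorem poisson_pow_succ_onRight_mulCoord (l : ℕ) (i : Idx N) (τ : Two N) :
    (poisson N ^ (l + 1)) (onRight (mulCoord i) τ) =
      onRight (mulCoord i) ((poisson N ^ (l + 1)) τ) -
        ((l + 1 : ℕ) : ℂ) • (poisson N ^ l) (onLeft (ham i) τ) := by
  have h0 := poisson_onRight_mulCoord (N := N) i
  rw [sub_eq_add_neg] at h0
  have h := pow_succ_mul_of_commutator h0
    (by rw [end_mul_neg, end_neg_mul, commute_poisson_onLeft_ham i]) l
  have h' := LinearMap.congr_fun h τ
  rw [commute_pow_apply (commute_poisson_onLeft_ham i), Nat.cast_smul_eq_nsmul, sub_eq_add_neg,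
    ← smul_neg]
  exact h'

/-- The smooth function defined by a polynomial in the coordinates. -/
def poly : MvPolynomial (Idx N) ℂ →ₐ[ℂ] Smooth N := MvPolynomial.aeval coordinate

theorem toFun_poly (a : MvPolynomial (Idx N) ℂ) : toFun (poly a) = polyFun a := by
  funext z
  have h : ((Pi.evalAlgHom ℂ (fun _ : Phase N => ℂ) z).comp toFun).comp poly =
      MvPolynomial.aeval (fun i => coordFun i z) := by
    ext i
    simp [poly, coordinate]
  have h' := DFunLike.congr_fun h a
  rw [MvPolynomial.aeval_eq_eval] at h'
  exact h'

/-- Each coordinate factor raises the order of nilpotency by at most one. The commutator term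
replaces `g` by `ham i g`, which is why the bound in `FiniteOrder` has to be uniform in `g`. -/
theorem finiteOrder_poly (a : MvPolynomial (Idx N) ℂ) : FiniteOrder (poly a) := by
  induction a using MvPolynomial.induction_on with
  | C c =>
    refine ⟨1, fun g => ?_⟩
    rw [pow_one, poisson, LinearMap.sum_apply]
    refine Finset.sum_eq_zero fun i _ => ?_
    rw [onLeft_onRight_comm]
    simp [poly, Smooth.partialDeriv, deriv_algebraMap]
  | add a b ha hb =>
    obtain ⟨M, hM⟩ := ha
    obtain ⟨M', hM'⟩ := hb
    refine ⟨max M M', fun g => ?_⟩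
    rw [map_add, TensorProduct.add_tmul, map_add, poisson_pow_eq_zero_of_le (le_max_left _ _) (hM g),
      poisson_pow_eq_zero_of_le (le_max_right _ _) (hM' g), add_zero]
  | mul_X a i ha =>
    obtain ⟨M, hM⟩ := ha
    refine ⟨M + 1, fun g => ?_⟩
    have h : poly (a * MvPolynomial.X i) ⊗ₜ g = onLeft (mulCoord i) (poly a ⊗ₜ[ℂ] g) := by
      simp [poly, mul_comm]
    rw [h, poisson_pow_succ_onLeft_mulCoord, poisson_pow_eq_zero_of_le M.le_succ (hM g), map_zero,
      zero_add]
    simp [hM]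

theorem FiniteOrder.seriesTerminate_left {f : Smooth N} (hf : FiniteOrder f) (g : Smooth N) :
    SeriesTerminate (toFun f) (toFun g) := by
  obtain ⟨M, hM⟩ := hf
  refine ⟨M, fun l hl z => ?_⟩
  rw [biDiffPow_toFun, poisson_pow_eq_zero_of_le hl (hM g), map_zero, map_zero, Pi.zero_apply]

theorem FiniteOrder.seriesTerminate_right {f : Smooth N} (hf : FiniteOrder f) (g : Smooth N) :
    SeriesTerminate (toFun g) (toFun f) := by
  obtain ⟨M, hM⟩ := hf.right
  refine ⟨M, fun l hl z => ?_⟩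
  rw [biDiffPow_toFun, poisson_pow_eq_zero_of_le hl (hM g), map_zero, map_zero, Pi.zero_apply]

/-! ### The star product -/

/-- The partial sums of `exp (c Λ)`, followed by multiplication of the factors. -/
def starSum (c : ℂ) (M : ℕ) : Two N →ₗ[ℂ] Smooth N :=
  ∑ l ∈ Finset.range M, (c ^ l / (l.factorial : ℂ)) • (merge N ∘ₗ poisson N ^ l)

theorem starSum_apply (c : ℂ) (M : ℕ) (τ : Two N) :
    starSum c M τ = ∑ l ∈ Finset.range M,
      (c ^ l / (l.factorial : ℂ)) • merge N ((poisson N ^ l) τ) := by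
  simp [starSum, LinearMap.sum_apply]

theorem starSum_eq_of_le (c : ℂ) {M M' : ℕ} (h : M ≤ M') {τ : Two N}
    (hτ : (poisson N ^ M) τ = 0) : starSum c M' τ = starSum c M τ := by
  rw [starSum_apply, starSum_apply]
  symm
  refine Finset.sum_subset (Finset.range_mono h) fun l _ hl => ?_
  rw [poisson_pow_eq_zero_of_le (by simpa using hl) hτ, map_zero, smul_zero]

theorem moyal_toFun (ħ : ℝ) (M : ℕ) (f g : Smooth N) (h : (poisson N ^ M) (f ⊗ₜ g) = 0) :
    moyal ħ (toFun f) (toFun g) = toFun (starSum (Complex.I * ħ / 2) M (f ⊗ₜ g)) := by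
  funext z
  rw [moyal, tsum_eq_sum (s := Finset.range M), starSum_apply, map_sum, Finset.sum_apply]
  · refine Finset.sum_congr rfl fun l _ => ?_
    rw [biDiffPow_toFun, map_smul, Pi.smul_apply, smul_eq_mul]
  · intro l hl
    rw [biDiffPow_toFun, poisson_pow_eq_zero_of_le (by simpa using hl) h]
    simp

theorem merge_onLeft_mulCoord (i : Idx N) (τ : Two N) :
    merge N (onLeft (mulCoord i) τ) = coordinate i * merge N τ := by
  induction τ using TensorProduct.induction_on with
  | zero => simp
  | tmul f g => simp [merge_tmul, mul_assoc]
  | add a b ha hb => simp only [map_add, ha, hb, mul_add]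

theorem merge_onRight_mulCoord (i : Idx N) (τ : Two N) :
    merge N (onRight (mulCoord i) τ) = coordinate i * merge N τ := by
  induction τ using TensorProduct.induction_on with
  | zero => simp
  | tmul f g => simp [merge_tmul, mul_left_comm]
  | add a b ha hb => simp only [map_add, ha, hb, mul_add]

/-- The factor `l + 1` produced by the commutator with `Λ ^ (l + 1)` lowers the index of the
exponential series by one. -/
theorem pow_succ_div_factorial_mul (c : ℂ) (l : ℕ) :
    c ^ (l + 1) / ((l + 1).factorial : ℂ) * ((l + 1 : ℕ) : ℂ) = c * (c ^ l / (l.factorial : ℂ)) := by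
  have h1 : (l.factorial : ℂ) ≠ 0 := by exact_mod_cast l.factorial_ne_zero
  have h2 : ((l + 1 : ℕ) : ℂ) ≠ 0 := by exact_mod_cast l.succ_ne_zero
  rw [Nat.factorial_succ]
  push_cast at h2 ⊢
  field_simp
  ring

/-- The commutator of `exp (c Λ)` with a coordinate is `c` times the commutator of `Λ` times `exp (c
Λ)`. For truncated series the last term is one order shorter. -/
theorem starSum_succ_onLeft_mulCoord (c : ℂ) (M : ℕ) (i : Idx N) (τ : Two N) :
    starSum c (M + 1) (onLeft (mulCoord i) τ) =
      coordinate i * starSum c (M + 1) τ + c • starSum c M (onRight (ham i) τ) := by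
  simp only [starSum_apply, Finset.sum_range_succ', poisson_pow_succ_onLeft_mulCoord, map_add,
    merge_onLeft_mulCoord, pow_zero, Module.End.one_apply, smul_add, Finset.sum_add_distrib,
    Finset.smul_sum, mul_add, Finset.mul_sum, mul_smul_comm, map_smul, smul_smul,
    pow_succ_div_factorial_mul]
  abel

theorem starSum_succ_onRight_mulCoord (c : ℂ) (M : ℕ) (i : Idx N) (τ : Two N) :
    starSum c (M + 1) (onRight (mulCoord i) τ) =
      coordinate i * starSum c (M + 1) τ - c • starSum c M (onLeft (ham i) τ) := by
  simp only [starSum_apply, Finset.sum_range_succ', poisson_pow_succ_onRight_mulCoord, map_sub,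
    merge_onRight_mulCoord, pow_zero, Module.End.one_apply, smul_sub, Finset.sum_sub_distrib,
    Finset.smul_sum, mul_add, Finset.mul_sum, mul_smul_comm, map_smul, smul_smul,
    pow_succ_div_factorial_mul]
  abel

theorem ham_mul (i : Idx N) (f g : Smooth N) : ham i (f * g) = ham i f * g + f * ham i g := by
  rcases i with n | n
  · change -deriv _ _ = -deriv _ _ * _ + _ * -deriv _ _
    rw [deriv_mul]
    ring
  · exact deriv_mul _ _ _

theorem derivation_merge {A : Module.End ℂ (Smooth N)}
    (hA : ∀ f g, A (f * g) = A f * g + f * A g) (τ : Two N) :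
    A (merge N τ) = merge N (onLeft A τ) + merge N (onRight A τ) := by
  induction τ using TensorProduct.induction_on with
  | zero => simp
  | tmul f g => simp [merge_tmul, hA]
  | add a b ha hb =>
    simp only [map_add, ha, hb]
    abel

theorem ham_starSum (c : ℂ) (M : ℕ) (i : Idx N) (τ : Two N) :
    ham i (starSum c M τ) = starSum c M (onLeft (ham i) τ) + starSum c M (onRight (ham i) τ) := by
  simp only [starSum_apply, map_sum, map_smul, derivation_merge (ham_mul i), smul_add,
    Finset.sum_add_distrib, commute_pow_apply (commute_poisson_onLeft_ham i),
    commute_pow_apply (commute_poisson_onRight_ham i)]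

/-- The recursion matching Weyl symmetrization. For `c = iħ/2` and `τ = f ⊗ g`, the right side is
the mean of `f ⋆ (Bopp shift of g)` and the Bopp shift of `f ⋆ g`; the derivatives falling on `f`
cancel between the two. -/
theorem starSum_onLeft_mulCoord (c : ℂ) {M : ℕ} (i : Idx N) {τ : Two N}
    (hτ : (poisson N ^ M) τ = 0) :
    starSum c (M + 1) (onLeft (mulCoord i) τ) = (1 / 2 : ℂ) •
      (starSum c (M + 1) (onRight (mulCoord i) τ) + c • starSum c (M + 1) (onRight (ham i) τ) +
        (coordinate i * starSum c (M + 1) τ + c • ham i (starSum c (M + 1) τ))) := by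
  have h1 := starSum_eq_of_le c M.le_succ (τ := onLeft (ham i) τ)
    (by rw [commute_pow_apply (commute_poisson_onLeft_ham i), hτ, map_zero])
  have h2 := starSum_eq_of_le c M.le_succ (τ := onRight (ham i) τ)
    (by rw [commute_pow_apply (commute_poisson_onRight_ham i), hτ, map_zero])
  rw [starSum_succ_onLeft_mulCoord, starSum_succ_onRight_mulCoord, ham_starSum, h1, h2]
  module

/-- The mirror image, matching right multiplication: the Bopp shift has the opposite sign, and now
the derivatives falling on the right factor cancel. -/
theorem starSum_onRight_mulCoord (c : ℂ) {M : ℕ} (i : Idx N) {τ : Two N}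
    (hτ : (poisson N ^ M) τ = 0) :
    starSum c (M + 1) (onRight (mulCoord i) τ) = (1 / 2 : ℂ) •
      (starSum c (M + 1) (onLeft (mulCoord i) τ) - c • starSum c (M + 1) (onLeft (ham i) τ) +
        (coordinate i * starSum c (M + 1) τ - c • ham i (starSum c (M + 1) τ))) := by
  have h1 := starSum_eq_of_le c M.le_succ (τ := onLeft (ham i) τ)
    (by rw [commute_pow_apply (commute_poisson_onLeft_ham i), hτ, map_zero])
  have h2 := starSum_eq_of_le c M.le_succ (τ := onRight (ham i) τ)
    (by rw [commute_pow_apply (commute_poisson_onRight_ham i), hτ, map_zero])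
  rw [starSum_succ_onLeft_mulCoord, starSum_succ_onRight_mulCoord, ham_starSum, h1, h2]
  module

theorem merge_comm (τ : Two N) : merge N (TensorProduct.comm ℂ _ _ τ) = merge N τ := by
  induction τ using TensorProduct.induction_on with
  | zero => simp
  | tmul f g => simp [merge_tmul, mul_comm]
  | add a b ha hb => simp only [map_add, ha, hb]

theorem starSum_tmul_comm (c : ℂ) (M : ℕ) (f g : Smooth N) :
    starSum c M (f ⊗ₜ g) = starSum (-c) M (g ⊗ₜ f) := by
  rw [starSum_apply, starSum_apply]
  refine Finset.sum_congr rfl fun l _ => ?_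
  rw [← merge_comm, comm_poisson_pow, TensorProduct.comm_tmul, map_smul, smul_smul, neg_pow c]
  congr 1
  ring

/-! ### The sinc product -/

/-- The partial sums of `sinc (ħ Λ / 2)`, followed by multiplication of the factors. -/
def sincSum (ħ : ℝ) (M : ℕ) : Two N →ₗ[ℂ] Smooth N :=
  ∑ l ∈ Finset.range M, ((-1 : ℂ) ^ l * ((ħ : ℂ) / 2) ^ (2 * l) / ((2 * l + 1).factorial : ℂ)) •
    (merge N ∘ₗ poisson N ^ (2 * l))

theorem sincSum_apply (ħ : ℝ) (M : ℕ) (τ : Two N) :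
    sincSum ħ M τ = ∑ l ∈ Finset.range M,
      ((-1 : ℂ) ^ l * ((ħ : ℂ) / 2) ^ (2 * l) / ((2 * l + 1).factorial : ℂ)) •
        merge N ((poisson N ^ (2 * l)) τ) := by
  simp [sincSum, LinearMap.sum_apply]

theorem sincProd_toFun (ħ : ℝ) (M : ℕ) (f g : Smooth N) (h : (poisson N ^ M) (f ⊗ₜ g) = 0) :
    sincProd ħ (toFun f) (toFun g) = toFun (sincSum ħ M (f ⊗ₜ g)) := by
  funext z
  rw [sincProd, tsum_eq_sum (s := Finset.range M), sincSum_apply, map_sum, Finset.sum_apply]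
  · refine Finset.sum_congr rfl fun l _ => ?_
    rw [biDiffPow_toFun, map_smul, Pi.smul_apply, smul_eq_mul]
  · intro l hl
    rw [Finset.mem_range, not_lt] at hl
    -- `M` terms are more than enough, since `M ≤ l` implies `M ≤ 2 * l`.
    rw [biDiffPow_toFun, poisson_pow_eq_zero_of_le (by omega) h]
    simp

/-- The Poisson bracket is a divergence: in `∂ₓ(f ∂ₚg) - ∂ₚ(f ∂ₓg)` the terms with second
derivatives of `g` cancel. -/
theorem merge_poisson (τ : Two N) : merge N (poisson N τ) = ∑ n : Fin N,
    (partialDeriv (Sum.inr n) (merge N (onRight (partialDeriv (Sum.inl n)) τ)) -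
      partialDeriv (Sum.inl n) (merge N (onRight (partialDeriv (Sum.inr n)) τ))) := by
  rw [poisson_eq_sum, LinearMap.sum_apply, map_sum]
  refine Finset.sum_congr rfl fun n _ => ?_
  have h (i : Idx N) := derivation_merge (A := partialDeriv i) (deriv_mul _)
  have h2 : onRight (partialDeriv (Sum.inr n)) (onRight (partialDeriv (Sum.inl n)) τ) =
      onRight (partialDeriv (Sum.inl n)) (onRight (partialDeriv (Sum.inr n)) τ) := by
    rw [← Module.End.mul_apply, ← onRight_mul, partialDeriv_comm, onRight_mul, Module.End.mul_apply]
  rw [h, h, h2, LinearMap.sub_apply, map_sub, Module.End.mul_apply, Module.End.mul_apply]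
  abel

theorem sum_range_two_mul {A : Type*} [AddCommMonoid A] (f : ℕ → A) (M : ℕ) :
    ∑ l ∈ Finset.range (2 * M), f l = ∑ l ∈ Finset.range M, (f (2 * l) + f (2 * l + 1)) := by
  induction M with
  | zero => simp
  | succ M ih =>
    rw [Finset.sum_range_succ, ← ih, show 2 * (M + 1) = 2 * M + 1 + 1 by ring,
      Finset.sum_range_succ, Finset.sum_range_succ, add_assoc]

/-- The even terms of the exponentials cancel and the odd ones double, which gives `iħ sinc(ħΛ/2)
Λ`; `merge_poisson` turns one `Λ` into the divergence. The first `2 * M` terms of the exponentials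
correspond to exactly `M` terms of the sinc series. -/
theorem starSum_sub_starSum_neg (ħ : ℝ) (M : ℕ) (τ : Two N) :
    starSum (Complex.I * ħ / 2) (2 * M) τ - starSum (-(Complex.I * ħ / 2)) (2 * M) τ =
      (Complex.I * ħ) • ∑ n : Fin N,
        (partialDeriv (Sum.inr n) (sincSum ħ M (onRight (partialDeriv (Sum.inl n)) τ)) -
          partialDeriv (Sum.inl n) (sincSum ħ M (onRight (partialDeriv (Sum.inr n)) τ))) := by
  have hR : ∑ n : Fin N,
        (partialDeriv (Sum.inr n) (sincSum ħ M (onRight (partialDeriv (Sum.inl n)) τ)) -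
          partialDeriv (Sum.inl n) (sincSum ħ M (onRight (partialDeriv (Sum.inr n)) τ))) =
      ∑ l ∈ Finset.range M,
        ((-1 : ℂ) ^ l * ((ħ : ℂ) / 2) ^ (2 * l) / ((2 * l + 1).factorial : ℂ)) •
          merge N ((poisson N ^ (2 * l + 1)) τ) := by
    simp only [sincSum_apply, map_sum, map_smul,
      commute_pow_apply (commute_poisson_onRight_partialDeriv _), ← Finset.sum_sub_distrib,
      ← smul_sub]
    rw [Finset.sum_comm]
    refine Finset.sum_congr rfl fun l _ => ?_
    rw [← Finset.smul_sum, ← merge_poisson, ← Module.End.mul_apply, ← pow_succ']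
  rw [hR, starSum_apply, starSum_apply, ← Finset.sum_sub_distrib, sum_range_two_mul,
    Finset.smul_sum]
  refine Finset.sum_congr rfl fun l _ => ?_
  rw [← sub_smul, ← sub_smul, smul_smul, Even.neg_pow ⟨l, by ring⟩, sub_self, zero_smul, zero_add,
    Odd.neg_pow ⟨l, by ring⟩]
  congr 1
  have hI : Complex.I ^ (2 * l + 1) = (-1) ^ l * Complex.I := by
    rw [pow_succ, pow_mul, Complex.I_sq]
  rw [mul_div_assoc, mul_pow, hI, pow_succ]
  ring

end Smooth

end WignerFlow

end

/-! ### Weyl quantization and its compatibility with the star product. -/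

noncomputable section

namespace WignerFlow

variable {N : ℕ}

open MeasureTheory
open scoped TensorProduct

/-! ### Weyl quantization -/

/-- `Quantizes ħ A Λ R a`: the operator `A` is the Weyl quantization of the polynomial `a`, and
`Λ`, `R` are the actions on kernels of left and right multiplication by `A`.  The product of `a`
with a coordinate is quantized by the symmetrized product. -/
inductive Quantizes (ħ : ℝ) : Op N → Module.End ℂ (Ker N) → Module.End ℂ (Ker N) →
    MvPolynomial (Idx N) ℂ → Prop
  | one : Quantizes ħ 1 1 1 1
  | smul {A Λ R a} (c : ℂ) : Quantizes ħ A Λ R a →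
      Quantizes ħ (c • A) (c • Λ) (c • R) (MvPolynomial.C c * a)
  | add {A Λ R a A' Λ' R' a'} : Quantizes ħ A Λ R a → Quantizes ħ A' Λ' R' a' →
      Quantizes ħ (A + A') (Λ + Λ') (R + R') (a + a')
  | mul_gen {A Λ R a} (i : Idx N) : Quantizes ħ A Λ R a →
      Quantizes ħ ((1 / 2 : ℂ) • (A * gen ħ i + gen ħ i * A))
        ((1 / 2 : ℂ) • (Λ * genLeft ħ i + genLeft ħ i * Λ))
        ((1 / 2 : ℂ) • (R * genRight ħ i + genRight ħ i * R)) (a * MvPolynomial.X i)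

/-- The Wigner transform as a linear map to smooth functions. -/
def smoothWigner (ħ : ℝ) : Ker N →ₗ[ℂ] Smooth N where
  toFun K := Smooth.mk (wigner ħ K) (contDiff_wigner ħ K)
  map_add' K K' := by
    ext z
    rw [map_add]
    exact congrFun (wigner_add ħ K K') z
  map_smul' c K := by
    ext z
    rw [map_smul]
    exact congrFun (wigner_smul ħ c K) z

theorem toFun_smoothWigner (ħ : ℝ) (K : Ker N) :
    Smooth.toFun (smoothWigner ħ K) = wigner ħ K := rfl

theorem toFun_ham (i : Idx N) (f : Smooth N) :
    Smooth.toFun (Smooth.ham i f) = hamDeriv i (Smooth.toFun f) := by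
  rcases i with n | n <;> rfl

theorem smoothWigner_genLeft {ħ : ℝ} (hħ : ħ ≠ 0) (i : Idx N) (K : Ker N) :
    smoothWigner ħ (genLeft ħ i K) = Smooth.coordinate i * smoothWigner ħ K +
      (Complex.I * ħ / 2) • Smooth.ham i (smoothWigner ħ K) := by
  ext z
  rw [toFun_smoothWigner, wigner_genLeft ħ hħ, map_add, map_mul, map_smul, toFun_ham]
  rfl

theorem smoothWigner_genRight {ħ : ℝ} (hħ : ħ ≠ 0) (i : Idx N) (K : Ker N) :
    smoothWigner ħ (genRight ħ i K) = Smooth.coordinate i * smoothWigner ħ K -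
      (Complex.I * ħ / 2) • Smooth.ham i (smoothWigner ħ K) := by
  ext z
  rw [toFun_smoothWigner, wigner_genRight ħ hħ, map_sub, map_mul, map_smul, toFun_ham]
  rfl

theorem Smooth.starSum_one_tmul (c : ℂ) {M : ℕ} (hM : 1 ≤ M) (f : Smooth N) :
    Smooth.starSum c M (1 ⊗ₜ f) = f := by
  have h (g : Smooth N) : (Smooth.poisson N ^ 1) (1 ⊗ₜ g) = 0 := by
    rw [pow_one, Smooth.poisson, LinearMap.sum_apply]
    refine Finset.sum_eq_zero fun i _ => ?_
    have h1 := Smooth.deriv_algebraMap (Smooth.dir i) (N := N) 1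
    rw [map_one] at h1
    rw [Smooth.onLeft_onRight_comm]
    simp [Smooth.partialDeriv, h1]
  rw [Smooth.starSum_eq_of_le c hM (h f), Smooth.starSum_apply]
  simp [Smooth.merge_tmul]

theorem Smooth.starSum_tmul_one (c : ℂ) {M : ℕ} (hM : 1 ≤ M) (f : Smooth N) :
    Smooth.starSum c M (f ⊗ₜ 1) = f := by
  rw [Smooth.starSum_tmul_comm, Smooth.starSum_one_tmul _ hM]

theorem polyFun_mul_X (a : MvPolynomial (Idx N) ℂ) (i : Idx N) :
    polyFun (a * MvPolynomial.X i) = polyFun a * coordFun i := by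
  funext z
  simp only [polyFun, map_mul, MvPolynomial.eval_X, Pi.mul_apply]
  rfl

theorem conjFun_polyFun (a : MvPolynomial (Idx N) ℂ) :
    conjFun (polyFun a) = polyFun (MvPolynomial.map (starRingEnd ℂ) a) := by
  funext z
  rw [conjFun, polyFun, polyFun, MvPolynomial.eval_map, MvPolynomial.eval, MvPolynomial.coe_eval₂Hom,
    MvPolynomial.eval₂_comp_left (starRingEnd ℂ)]
  congr 1
  funext i
  rcases i with n | n <;> simp

namespace Quantizes

variable {ħ : ℝ} {A : Op N} {Λ R : Module.End ℂ (Ker N)} {a : MvPolynomial (Idx N) ℂ}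

theorem hasKernel_mul (h : Quantizes ħ A Λ R a) {ρ : Op N} {K : Ker N} (hK : HasKernel ρ K) :
    HasKernel (A * ρ) (Λ K) := by
  induction h generalizing ρ K with
  | one => simpa using hK
  | smul c h ih => simpa using (ih hK).smul c
  | add h h' ih ih' => simpa [add_mul] using (ih hK).add (ih' hK)
  | mul_gen i h ih =>
    have h1 := ((ih (hK.gen_mul (ħ := ħ) i)).add ((ih hK).gen_mul (ħ := ħ) i)).smul (1 / 2)
    rw [smul_mul_assoc, add_mul, mul_assoc, mul_assoc]
    exact h1

theorem hasKernel_mul_right (h : Quantizes ħ A Λ R a) {ρ : Op N} {K : Ker N}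
    (hK : HasKernel ρ K) : HasKernel (ρ * A) (R K) := by
  induction h generalizing ρ K with
  | one => simpa using hK
  | smul c h ih => simpa using (ih hK).smul c
  | add h h' ih ih' => simpa [mul_add] using (ih hK).add (ih' hK)
  | mul_gen i h ih =>
    have h1 := ((ih (hK.mul_gen (ħ := ħ) i)).add ((ih hK).mul_gen (ħ := ħ) i)).smul (1 / 2)
    rw [mul_smul_comm, mul_add, ← mul_assoc, ← mul_assoc, add_comm (ρ * _ * _)]
    exact h1

theorem comm_genRight (h : Quantizes ħ A Λ R a) (j : Idx N) :
    Λ * genRight ħ j = genRight ħ j * Λ := by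
  induction h with
  | one => simp
  | smul c h ih => rw [smul_mul_assoc, mul_smul_comm, ih]
  | add h h' ih ih' => rw [add_mul, mul_add, ih, ih']
  | @mul_gen A Λ R a i h ih =>
    have e1 : Λ * genLeft ħ i * genRight ħ j = genRight ħ j * (Λ * genLeft ħ i) := by
      rw [mul_assoc, genLeft_genRight_comm, ← mul_assoc, ih, mul_assoc]
    have e2 : genLeft ħ i * Λ * genRight ħ j = genRight ħ j * (genLeft ħ i * Λ) := by
      rw [mul_assoc, ih, ← mul_assoc, genLeft_genRight_comm, mul_assoc]
    rw [smul_mul_assoc, mul_smul_comm, add_mul, mul_add, e1, e2]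

theorem integrable_mul_wigner (hħ : ħ ≠ 0) (h : Quantizes ħ A Λ R a) (K : Ker N) :
    Integrable (polyFun a * wigner ħ K) := by
  induction h generalizing K with
  | one => simpa [polyFun, Pi.mul_def] using integrable_wigner ħ hħ K
  | smul c h ih => simpa [polyFun, Pi.mul_def, mul_assoc] using (ih K).const_mul c
  | add h h' ih ih' => simpa [polyFun, Pi.mul_def, Pi.add_def, add_mul] using (ih K).add (ih' K)
  | mul_gen i h ih =>
    rw [polyFun_mul_X, mul_assoc, coordFun_mul_wigner ħ hħ]
    exact ih _

/-- The trace of `A ρ` is the phase-space average of the symbol. In the inductive step a coordinate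
times `W` comes from the mean of the left and right actions; cyclicity for the generator, together
with `comm_genRight`, makes this the symmetrized product. -/
theorem kerTrace_eq (hħ : 0 < ħ) (h : Quantizes ħ A Λ R a) (K : Ker N) :
    kerTrace (Λ K) = ∫ z, (polyFun a * wigner ħ K) z := by
  induction h generalizing K with
  | one => simp [polyFun, integral_wigner ħ hħ]
  | smul c h ih =>
    rw [LinearMap.smul_apply, map_smul, ih, smul_eq_mul, ← integral_const_mul]
    simp [polyFun, mul_assoc]
  | add h h' ih ih' =>
    rw [LinearMap.add_apply, map_add, ih, ih', ← integral_add (h.integrable_mul_wigner hħ.ne' K)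
      (h'.integrable_mul_wigner hħ.ne' K)]
    simp [polyFun, add_mul]
  | @mul_gen A Λ R a i h ih =>
    rw [polyFun_mul_X, mul_assoc, coordFun_mul_wigner ħ hħ.ne', ← ih]
    have h1 := LinearMap.congr_fun (h.comm_genRight i) K
    rw [Module.End.mul_apply, Module.End.mul_apply] at h1
    simp only [LinearMap.smul_apply, LinearMap.add_apply, map_smul, map_add, Module.End.mul_apply,
      kerTrace_genLeft, h1]

/-- The trace formula for `|ψ⟩⟨φ|`: the trace of `|A ψ⟩⟨φ|` is the matrix element `⟨φ, A ψ⟩`. -/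
theorem isWeylSymbol (hħ : 0 < ħ) (h : Quantizes ħ A Λ R a) : IsWeylSymbol ħ A (polyFun a) := by
  intro φ ψ
  have h1 : Λ (rankOneKer ψ φ) = rankOneKer (A ψ) φ := by
    refine (h.hasKernel_mul (hasKernel_rankOneOp ψ φ)).kernel_unique ?_
    rw [mul_rankOneOp]
    exact hasKernel_rankOneOp _ _
  have h2 := h.kerTrace_eq hħ (rankOneKer ψ φ)
  rw [h1, kerTrace_apply, rankOneKer_coe, rankOneKer_coe] at h2
  refine Eq.trans ?_ h2
  simp [braket, mul_comm]

theorem smoothWigner_left (hħ : ħ ≠ 0) (h : Quantizes ħ A Λ R a) :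
    ∃ M₀, ∀ M, M₀ ≤ M → ∀ K, smoothWigner ħ (Λ K) =
      Smooth.starSum (Complex.I * ħ / 2) M (Smooth.poly a ⊗ₜ smoothWigner ħ K) := by
  induction h with
  | one => exact ⟨1, fun M hM K => by rw [map_one, Smooth.starSum_one_tmul _ hM]; rfl⟩
  | smul c h ih =>
    obtain ⟨M₀, hM⟩ := ih
    refine ⟨M₀, fun M hMM K => ?_⟩
    rw [LinearMap.smul_apply, map_smul, hM M hMM, MvPolynomial.C_mul', map_smul,
      ← TensorProduct.smul_tmul', map_smul]
  | add h h' ih ih' =>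
    obtain ⟨M₀, hM⟩ := ih
    obtain ⟨M₁, hM'⟩ := ih'
    refine ⟨max M₀ M₁, fun M hMM K => ?_⟩
    rw [LinearMap.add_apply, map_add, hM M (le_of_max_le_left hMM), hM' M (le_of_max_le_right hMM),
      ← map_add, map_add Smooth.poly, TensorProduct.add_tmul]
  | @mul_gen A Λ R a i h ih =>
    obtain ⟨M₀, hM⟩ := ih
    obtain ⟨M₁, hM'⟩ := Smooth.finiteOrder_poly a
    refine ⟨max M₀ M₁ + 1, fun M hMM K => ?_⟩
    -- The star recursion holds for a truncation one above the order of nilpotency of `poly a`.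
    obtain ⟨m, rfl⟩ := Nat.exists_eq_add_of_le' (le_trans (Nat.le_add_left 1 _) hMM)
    have hm : max M₀ M₁ ≤ m := by omega
    have e1 : Smooth.poly (a * MvPolynomial.X i) ⊗ₜ[ℂ] smoothWigner ħ K =
        Smooth.onLeft (Smooth.mulCoord i) (Smooth.poly a ⊗ₜ smoothWigner ħ K) := by
      simp [Smooth.poly, mul_comm]
    -- The induction hypothesis is needed at the shifted kernel as well, so the truncation bound is
    -- independent of `K`.
    have e2 := hM (m + 1) (by omega) (genLeft ħ i K)
    have e3 := hM (m + 1) (by omega) K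
    rw [smoothWigner_genLeft hħ, TensorProduct.tmul_add, TensorProduct.tmul_smul, map_add,
      map_smul] at e2
    rw [e1, Smooth.starSum_onLeft_mulCoord _ i
      (Smooth.poisson_pow_eq_zero_of_le (le_of_max_le_right hm) (hM' _)), ← e3,
      ← smoothWigner_genLeft hħ]
    simp only [LinearMap.smul_apply, LinearMap.add_apply, map_smul, map_add, Module.End.mul_apply]
    rw [e2]
    rfl

theorem smoothWigner_right (hħ : ħ ≠ 0) (h : Quantizes ħ A Λ R a) :
    ∃ M₀, ∀ M, M₀ ≤ M → ∀ K, smoothWigner ħ (R K) =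
      Smooth.starSum (Complex.I * ħ / 2) M (smoothWigner ħ K ⊗ₜ Smooth.poly a) := by
  induction h with
  | one => exact ⟨1, fun M hM K => by rw [map_one, Smooth.starSum_tmul_one _ hM]; rfl⟩
  | smul c h ih =>
    obtain ⟨M₀, hM⟩ := ih
    refine ⟨M₀, fun M hMM K => ?_⟩
    rw [LinearMap.smul_apply, map_smul, hM M hMM, MvPolynomial.C_mul', map_smul,
      TensorProduct.tmul_smul, map_smul]
  | add h h' ih ih' =>
    obtain ⟨M₀, hM⟩ := ih
    obtain ⟨M₁, hM'⟩ := ih'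
    refine ⟨max M₀ M₁, fun M hMM K => ?_⟩
    rw [LinearMap.add_apply, map_add, hM M (le_of_max_le_left hMM), hM' M (le_of_max_le_right hMM),
      ← map_add, map_add Smooth.poly, TensorProduct.tmul_add]
  | @mul_gen A Λ R a i h ih =>
    obtain ⟨M₀, hM⟩ := ih
    obtain ⟨M₁, hM'⟩ := (Smooth.finiteOrder_poly a).right
    refine ⟨max M₀ M₁ + 1, fun M hMM K => ?_⟩
    obtain ⟨m, rfl⟩ := Nat.exists_eq_add_of_le' (le_trans (Nat.le_add_left 1 _) hMM)
    have hm : max M₀ M₁ ≤ m := by omega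
    have e1 : smoothWigner ħ K ⊗ₜ[ℂ] Smooth.poly (a * MvPolynomial.X i) =
        Smooth.onRight (Smooth.mulCoord i) (smoothWigner ħ K ⊗ₜ Smooth.poly a) := by
      simp [Smooth.poly, mul_comm]
    have e2 := hM (m + 1) (by omega) (genRight ħ i K)
    have e3 := hM (m + 1) (by omega) K
    rw [smoothWigner_genRight hħ, TensorProduct.sub_tmul, ← TensorProduct.smul_tmul', map_sub,
      map_smul] at e2
    rw [e1, Smooth.starSum_onRight_mulCoord _ i
      (Smooth.poisson_pow_eq_zero_of_le (le_of_max_le_right hm) (hM' _)), ← e3,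
      ← smoothWigner_genRight hħ]
    simp only [LinearMap.smul_apply, LinearMap.add_apply, map_smul, map_add, Module.End.mul_apply]
    rw [e2]
    rfl

/-- The adjoint reverses products, and the symmetrized product with a self-adjoint generator is
insensitive to the order. -/
theorem exists_adjoint (h : Quantizes ħ A Λ R a) : ∃ A' Λ' R',
    Quantizes ħ A' Λ' R' (MvPolynomial.map (starRingEnd ℂ) a) ∧ IsAdjoint A A' := by
  induction h with
  | one => exact ⟨1, 1, 1, by simpa using Quantizes.one, fun φ ψ => rfl⟩
  | smul c h ih =>
    obtain ⟨A', Λ', R', h1, h2⟩ := ih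
    exact ⟨_, _, _, by simpa using h1.smul (conj c), h2.smul c⟩
  | add h h' ih ih' =>
    obtain ⟨A', Λ', R', h1, h2⟩ := ih
    obtain ⟨A'', Λ'', R'', h1', h2'⟩ := ih'
    exact ⟨_, _, _, by simpa using h1.add h1', h2.add h2'⟩
  | mul_gen i h ih =>
    obtain ⟨A', Λ', R', h1, h2⟩ := ih
    have h1' := h1.mul_gen i
    refine ⟨_, _, _, by rw [map_mul, MvPolynomial.map_X]; exact h1', ?_⟩
    have h3 := ((h2.mul (isAdjoint_gen ħ i)).add ((isAdjoint_gen ħ i).mul h2)).smul (1 / 2)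
    have hc : conj (1 / 2 : ℂ) = 1 / 2 := by rw [map_div₀, map_one, map_ofNat]
    rw [hc] at h3
    rw [add_comm (A' * _)]
    exact h3

theorem exists_commutator (h : Quantizes ħ A Λ R a) (j : Idx N) : ∃ B Λ' R' b,
    Quantizes ħ B Λ' R' b ∧ gen ħ j * A = A * gen ħ j + B := by
  induction h with
  | one => exact ⟨_, _, _, _, Quantizes.one.smul 0, by simp⟩
  | smul c h ih =>
    obtain ⟨B, _, _, _, h1, h2⟩ := ih
    exact ⟨_, _, _, _, h1.smul c, by rw [mul_smul_comm, h2, smul_add, smul_mul_assoc]⟩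
  | add h h' ih ih' =>
    obtain ⟨B, _, _, _, h1, h2⟩ := ih
    obtain ⟨B', _, _, _, h1', h2'⟩ := ih'
    exact ⟨_, _, _, _, h1.add h1', by rw [mul_add, h2, h2', add_mul]; abel⟩
  | @mul_gen A Λ R a i h ih =>
    obtain ⟨B, _, _, _, h1, h2⟩ := ih
    obtain ⟨c, hc⟩ := gen_commutator ħ j i
    refine ⟨_, _, _, _, (h1.mul_gen i).add (h.smul c), ?_⟩
    have e1 : gen ħ j * (A * gen ħ i) = A * gen ħ i * gen ħ j + c • A + B * gen ħ i := by
      rw [← mul_assoc, h2, add_mul, mul_assoc, hc, mul_add, mul_smul_comm, mul_one, ← mul_assoc]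
    have e2 : gen ħ j * (gen ħ i * A) = gen ħ i * A * gen ħ j + gen ħ i * B + c • A := by
      rw [← mul_assoc, hc, add_mul, mul_assoc, h2, mul_add, smul_one_mul, ← mul_assoc]
    rw [mul_smul_comm, mul_add, e1, e2, smul_mul_assoc, add_mul]
    module

theorem exists_op (ħ : ℝ) (a : MvPolynomial (Idx N) ℂ) : ∃ A Λ R, Quantizes ħ A Λ R a := by
  induction a using MvPolynomial.induction_on with
  | C c => exact ⟨_, _, _, by simpa using Quantizes.one.smul c⟩
  | add a b ha hb =>
    obtain ⟨_, _, _, h⟩ := ha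
    obtain ⟨_, _, _, h'⟩ := hb
    exact ⟨_, _, _, h.add h'⟩
  | mul_X a i ha =>
    obtain ⟨_, _, _, h⟩ := ha
    exact ⟨_, _, _, h.mul_gen i⟩

end Quantizes

theorem IsWeylSymbol.op_unique {ħ : ℝ} {A B : Op N} {a : Phase N → ℂ} (hA : IsWeylSymbol ħ A a)
    (hB : IsWeylSymbol ħ B a) : A = B :=
  op_eq_of_braket fun φ ψ => by rw [hA, hB]

/-- A symbol determines its operator, so every polynomial symbol of `A` arises by quantization. This
applies to the polynomial chosen in `weylSymbol`, without uniqueness of symbols. -/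
theorem quantizes_of_isWeylSymbol {ħ : ℝ} (hħ : 0 < ħ) {A : Op N} {a : MvPolynomial (Idx N) ℂ}
    (h : IsWeylSymbol ħ A (polyFun a)) : ∃ Λ R, Quantizes ħ A Λ R a := by
  obtain ⟨B, Λ, R, hB⟩ := Quantizes.exists_op ħ a
  rw [h.op_unique (hB.isWeylSymbol hħ)]
  exact ⟨Λ, R, hB⟩

theorem exists_quantizes_of_mem_polyOps {ħ : ℝ} {A : Op N} (hA : A ∈ polyOps ħ N) :
    ∃ Λ R a, Quantizes ħ A Λ R a := by
  -- Stated as stability under left multiplication by `A`, the claim passes to products by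
  -- composition; no formula for the symbol of a product is needed.
  suffices h : ∀ B, (∃ Λ R b, Quantizes ħ B Λ R b) → ∃ Λ R a, Quantizes ħ (A * B) Λ R a by
    simpa using h 1 ⟨_, _, _, Quantizes.one⟩
  have hgen (j : Idx N) (B : Op N) (hB : ∃ Λ R b, Quantizes ħ B Λ R b) :
      ∃ Λ R a, Quantizes ħ (gen ħ j * B) Λ R a := by
    obtain ⟨Λ, R, b, hB⟩ := hB
    obtain ⟨C, Λ', R', c, hC, hC'⟩ := hB.exists_commutator j
    have h := (hB.mul_gen j).add (hC.smul (1 / 2))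
    -- A one-sided product is the symmetrized product plus half the commutator `C`, which is itself
    -- a quantized polynomial.
    have e : (1 / 2 : ℂ) • (B * gen ħ j + gen ħ j * B) + (1 / 2 : ℂ) • C = gen ħ j * B := by
      rw [hC']
      module
    rw [e] at h
    exact ⟨_, _, _, h⟩
  induction hA using Algebra.adjoin_induction with
  | mem A hA =>
    rcases hA with ⟨n, rfl⟩ | ⟨n, rfl⟩
    · exact hgen (Sum.inr n)
    · exact hgen (Sum.inl n)
  | algebraMap c =>
    rintro B ⟨_, _, _, hB⟩
    rw [Algebra.algebraMap_eq_smul_one, smul_one_mul]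
    exact ⟨_, _, _, hB.smul c⟩
  | add A A' _ _ h h' =>
    intro B hB
    obtain ⟨_, _, _, h1⟩ := h B hB
    obtain ⟨_, _, _, h2⟩ := h' B hB
    rw [add_mul]
    exact ⟨_, _, _, h1.add h2⟩
  | mul A A' _ _ h h' =>
    intro B hB
    rw [mul_assoc]
    exact h _ (h' B hB)

theorem exists_weylSymbol_eq {ħ : ℝ} (hħ : 0 < ħ) {A : Op N} (hA : A ∈ polyOps ħ N) :
    ∃ Λ R a, Quantizes ħ A Λ R a ∧ weylSymbol ħ A = polyFun a := by
  obtain ⟨_, _, a, h⟩ := exists_quantizes_of_mem_polyOps hA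
  have hex : ∃ a, IsWeylSymbol ħ A (polyFun a) := ⟨a, h.isWeylSymbol hħ⟩
  obtain ⟨Λ, R, h'⟩ := quantizes_of_isWeylSymbol hħ hex.choose_spec
  exact ⟨Λ, R, _, h', by rw [weylSymbol, dif_pos hex]⟩

end WignerFlow

end

/-! ### Complex conjugation, commutators as divergences, and the time derivative. -/

noncomputable section

namespace WignerFlow

variable {N : ℕ}

open scoped TensorProduct

/-! ### Complex conjugation of smooth functions -/

namespace Smooth

theorem fderiv_conjFun (f : Smooth N) (z v : Phase N) :
    fderiv ℝ (conjFun (toFun f)) z v = conj (fderiv ℝ (toFun f) z v) := by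
  have h := (Complex.conjCLE.toContinuousLinearMap.hasFDerivAt (x := toFun f z)).comp z
    (f.differentiableAt z).hasFDerivAt
  exact congrArg (fun L : Phase N →L[ℝ] ℂ => L v) h.fderiv

/-- Pointwise complex conjugation. -/
def conjugate : Smooth N →+ Smooth N where
  toFun f := mk (conjFun (toFun f)) (Complex.conjCLE.contDiff.comp f.contDiff)
  map_zero' := by
    ext z
    exact map_zero (starRingEnd ℂ)
  map_add' f g := by
    ext z
    exact map_add (starRingEnd ℂ) _ _

theorem toFun_conjugate (f : Smooth N) : toFun (conjugate f) = conjFun (toFun f) := rfl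

theorem partialDeriv_conjugate (i : Idx N) (f : Smooth N) :
    partialDeriv i (conjugate f) = conjugate (partialDeriv i f) := by
  ext z
  exact fderiv_conjFun f z (dir i)

end Smooth

theorem smoothWigner_adjointKer (ħ : ℝ) (K : Ker N) :
    smoothWigner ħ (adjointKer K) = Smooth.conjugate (smoothWigner ħ K) := by
  ext z
  exact wigner_adjointKer ħ K z

/-! ### Commutators and the sinc product -/

namespace Quantizes

variable {ħ : ℝ} {A : Op N} {Λ R : Module.End ℂ (Ker N)} {a : MvPolynomial (Idx N) ℂ}

theorem moyal_wigner (hħ : ħ ≠ 0) (h : Quantizes ħ A Λ R a) (K : Ker N) :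
    moyal ħ (polyFun a) (wigner ħ K) = wigner ħ (Λ K) := by
  obtain ⟨M, hM⟩ := h.smoothWigner_left hħ
  obtain ⟨M', hM'⟩ := Smooth.finiteOrder_poly a
  rw [← Smooth.toFun_poly, ← toFun_smoothWigner, Smooth.moyal_toFun ħ (max M M') _ _
    (Smooth.poisson_pow_eq_zero_of_le (le_max_right _ _) (hM' _)), ← hM _ (le_max_left _ _),
    toFun_smoothWigner]

/-- The left side is `W ⋆ a - a ⋆ W`. Exchanging the factors in the second product changes the sign
of `Λ`, and `Smooth.starSum_sub_starSum_neg` applies. -/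
theorem exists_commutator_flow (hħ : ħ ≠ 0) (h : Quantizes ħ A Λ R a) (K : Ker N) :
    ∃ P Q : Fin N → Smooth N,
      (∀ n, sincProd ħ (wigner ħ K) (dP n (polyFun a)) = Smooth.toFun (P n)) ∧
      (∀ n, sincProd ħ (wigner ħ K) (dX n (polyFun a)) = Smooth.toFun (Q n)) ∧
      smoothWigner ħ (R K - Λ K) = (Complex.I * ħ) • ∑ n,
        (Smooth.partialDeriv (Sum.inr n) (P n) - Smooth.partialDeriv (Sum.inl n) (Q n)) := by
  obtain ⟨M₁, h₁⟩ := h.smoothWigner_left hħ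
  obtain ⟨M₂, h₂⟩ := h.smoothWigner_right hħ
  obtain ⟨M₃, h₃⟩ := (Smooth.finiteOrder_poly a).right
  set M := max M₁ (max M₂ M₃) with hM
  have hsinc (i : Idx N) : sincProd ħ (wigner ħ K)
      (Smooth.toFun (Smooth.partialDeriv i (Smooth.poly a))) =
        Smooth.toFun (Smooth.sincSum ħ M (Smooth.onRight (Smooth.partialDeriv i)
          (smoothWigner ħ K ⊗ₜ Smooth.poly a))) := by
    refine Smooth.sincProd_toFun ħ M (smoothWigner ħ K) _ ?_
    have h := Smooth.commute_pow_apply (Smooth.commute_poisson_onRight_partialDeriv i) M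
      (smoothWigner ħ K ⊗ₜ Smooth.poly a)
    rw [Smooth.poisson_pow_eq_zero_of_le (by omega) (h₃ _), map_zero] at h
    exact h
  rw [← Smooth.toFun_poly]
  refine ⟨_, _, fun n => hsinc (Sum.inl n), fun n => hsinc (Sum.inr n), ?_⟩
  -- The star sums are truncated at `2 * M` to match `M` sinc terms; both truncations lie beyond the
  -- required bounds.
  rw [← Smooth.starSum_sub_starSum_neg, map_sub, h₁ (2 * M) (by omega), h₂ (2 * M) (by omega),
    Smooth.starSum_tmul_comm _ _ (Smooth.poly a)]

theorem seriesTerminate_wigner (_ : Quantizes ħ A Λ R a) (K : Ker N) (n : Fin N) :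
    SeriesTerminate (wigner ħ K) (dX n (polyFun a)) ∧
      SeriesTerminate (wigner ħ K) (dP n (polyFun a)) := by
  rw [← Smooth.toFun_poly]
  exact ⟨((Smooth.finiteOrder_poly a).partialDeriv (Sum.inr n)).seriesTerminate_right
      (smoothWigner ħ K),
    ((Smooth.finiteOrder_poly a).partialDeriv (Sum.inl n)).seriesTerminate_right
      (smoothWigner ħ K)⟩

theorem hasKernel_commutator (h : Quantizes ħ A Λ R a) {ρ : Op N} {K : Ker N}
    (hK : HasKernel ρ K) : HasKernel ⁅ρ, A⁆ (R K - Λ K : Ker N) :=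
  (h.hasKernel_mul_right hK).sub (h.hasKernel_mul hK)

end Quantizes

theorem phaseDiv_toFun (Jp Jx : Fin N → Smooth N) :
    phaseDiv (fun n => Smooth.toFun (Jp n)) (fun n => Smooth.toFun (Jx n)) =
      Smooth.toFun (∑ n, Smooth.partialDeriv (Sum.inl n) (Jp n) +
        ∑ n, Smooth.partialDeriv (Sum.inr n) (Jx n)) := by
  funext z
  simp only [map_add, map_sum, Pi.add_apply, Finset.sum_apply]
  rfl

theorem exists_quantizes_dagger {ħ : ℝ} (hħ : 0 < ħ) {A : Op N} (hA : A ∈ polyOps ħ N) :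
    ∃ Λ R a Λ' R' a', Quantizes ħ A Λ R a ∧ Quantizes ħ (dagger A) Λ' R' a' ∧
      weylSymbol ħ A = polyFun a ∧ conjFun (weylSymbol ħ A) = polyFun a' := by
  obtain ⟨Λ, R, a, h, ha⟩ := exists_weylSymbol_eq hħ hA
  obtain ⟨A', Λ', R', h', hadj⟩ := h.exists_adjoint
  rw [← hadj.dagger_eq] at h'
  exact ⟨Λ, R, a, Λ', R', _, h, h', ha, by rw [ha, conjFun_polyFun]⟩

/-- The derivative of the kernel is taken in the topological vector space of Schwartz functions,
which is not normed. The continuous linear functional is therefore applied to the little-o remainder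
itself. -/
theorem hasDerivWithinAt_wigner (ħ : ℝ) {K : ℝ → Ker N} {K' : Ker N} {I : Set ℝ} {t : ℝ}
    (h : HasDerivWithinAt K K' I t) (z : Phase N) :
    HasDerivWithinAt (fun s => wigner ħ (K s) z) (wigner ħ K' z) I t := by
  set T := (wignerCLM ħ z).restrictScalars ℝ with hT
  have hTK (s : ℝ) : wigner ħ (K s) z = T (K s) := (wignerCLM_apply ħ (K s) z).symm
  have h1 := h.isLittleOTVS
  refine ⟨((T.isBigOTVS_comp).trans_isLittleOTVS h1).congr_left fun p => ?_⟩
  simp only [hTK, Function.comp_apply, ContinuousLinearMap.toSpanSingleton_apply]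
  rw [map_sub T, map_sub T, map_smul T, ← wignerCLM_apply]
  rfl

/-- The prefactor `(i/ħ)(iħ) = -1` fixes the sign of the Hamiltonian part. In the dissipative part
`iħ` stays under the conjugation, which commutes with the real partial derivatives. -/
theorem generator_eq_neg_divergence {κ : Type*} [Fintype κ] {ħ : ℝ} (hħ : ħ ≠ 0) (P Q : Fin N → Smooth N)
    (P' Q' : κ → Fin N → Smooth N) :
    (Complex.I / ħ) • (Complex.I * ħ) • ∑ n,
        (Smooth.partialDeriv (Sum.inr n) (P n) - Smooth.partialDeriv (Sum.inl n) (Q n)) +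
      (1 / 2 : ℂ) • ∑ k, ((Complex.I * ħ) • ∑ n, (Smooth.partialDeriv (Sum.inr n) (P' k n) -
            Smooth.partialDeriv (Sum.inl n) (Q' k n)) +
          Smooth.conjugate ((Complex.I * ħ) • ∑ n, (Smooth.partialDeriv (Sum.inr n) (P' k n) -
            Smooth.partialDeriv (Sum.inl n) (Q' k n)))) =
    -(∑ n, Smooth.partialDeriv (Sum.inl n) (-Q n + (1 / 2 : ℂ) • ∑ k,
          ((Complex.I * ħ) • Q' k n + Smooth.conjugate ((Complex.I * ħ) • Q' k n))) +
      ∑ n, Smooth.partialDeriv (Sum.inr n) (P n - (1 / 2 : ℂ) • ∑ k,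
          ((Complex.I * ħ) • P' k n + Smooth.conjugate ((Complex.I * ħ) • P' k n)))) := by
  have hc : Complex.I / ħ * (Complex.I * ħ) = -1 := by
    have : (ħ : ℂ) ≠ 0 := by exact_mod_cast hħ
    field_simp
    simp
  rw [smul_smul, hc]
  simp only [map_add, map_sub, map_neg, map_smul, map_sum, Smooth.partialDeriv_conjugate,
    Finset.smul_sum, smul_add, smul_sub, Finset.sum_add_distrib, Finset.sum_sub_distrib,
    Finset.sum_neg_distrib]
  simp only [Finset.sum_comm (s := (Finset.univ : Finset κ)), neg_one_smul,
    Finset.sum_neg_distrib]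
  abel

end WignerFlow

end

/-! ### The continuity equation. -/

open WignerFlow in
theorem theorem1 {N : ℕ} {κ : Type*} [Fintype κ] (ħ : ℝ) (hħ : 0 < ħ)
    (H : Op N) (hH : H ∈ polyOps ħ N)
    (L : κ → ℝ → Op N → Op N)
    (I : Set ℝ) (ρ : ℝ → Op N) (K : ℝ → 𝓢(Conf N × Conf N, ℂ))
    (hL : ∀ k, ∀ t ∈ I, L k t (ρ t) ∈ polyOps ħ N)
    (hρ : SolvesMasterEq ħ H L I ρ K) :
    ∀ t ∈ I,
      FlowWellDefined ħ H (fun k => L k t (ρ t))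
        (weylSymbol ħ H) (fun k => weylSymbol ħ (L k t (ρ t))) (wigner ħ (K t)) ∧
      ∀ z : Phase N,
        HasDerivWithinAt (fun s => wigner ħ (K s) z)
          (-phaseDiv
            (flowP ħ (weylSymbol ħ H) (fun k => weylSymbol ħ (L k t (ρ t))) (wigner ħ (K t)))
            (flowX ħ (weylSymbol ħ H) (fun k => weylSymbol ħ (L k t (ρ t))) (wigner ħ (K t))) z)
          I t := by
  intro t ht
  obtain ⟨hK, K', hK', hkerK'⟩ := hρ t ht
  obtain ⟨ΛH, RH, h, hqH, hh⟩ := exists_weylSymbol_eq hħ hH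
  choose Λ R a Λ' R' a' hq hq' ha ha' using fun k => exists_quantizes_dagger hħ (hL k t ht)
  obtain ⟨P, Q, hP, hQ, hPQ⟩ := hqH.exists_commutator_flow hħ.ne' (K t)
  -- The dissipative commutator is taken at the kernel of `Lₖ ρ`, with `Lₖ†` in the role of the
  -- Hamiltonian.
  choose P' Q' hP' hQ' hPQ' using fun k =>
    (hq' k).exists_commutator_flow hħ.ne' (Λ k (K t))
  -- `ℓₖ ⋆ W` is itself a Wigner transform, so its sinc products are covered by the same lemmas as
  -- those of `W`.
  have hmoyal k : moyal ħ (weylSymbol ħ (L k t (ρ t))) (wigner ħ (K t)) =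
      wigner ħ (Λ k (K t)) := by
    rw [ha, (hq k).moyal_wigner hħ.ne']
  have hflowP : flowP ħ (weylSymbol ħ H) (fun k => weylSymbol ħ (L k t (ρ t))) (wigner ħ (K t)) =
      fun n => Smooth.toFun (-Q n + (1 / 2 : ℂ) • ∑ k,
        ((Complex.I * ħ) • Q' k n + Smooth.conjugate ((Complex.I * ħ) • Q' k n))) := by
    funext n z
    simp only [flowP, hmoyal, ha', hh, hQ, hQ', map_add, map_neg, map_smul, map_sum, Pi.add_apply,
      Pi.neg_apply, Pi.smul_apply, Finset.sum_apply, Smooth.toFun_conjugate, conjFun, smul_eq_mul]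
  have hflowX : flowX ħ (weylSymbol ħ H) (fun k => weylSymbol ħ (L k t (ρ t))) (wigner ħ (K t)) =
      fun n => Smooth.toFun (P n - (1 / 2 : ℂ) • ∑ k,
        ((Complex.I * ħ) • P' k n + Smooth.conjugate ((Complex.I * ħ) • P' k n))) := by
    funext n z
    simp only [flowX, hmoyal, ha', hh, hP, hP', map_add, map_sub, map_smul, map_sum, Pi.add_apply,
      Pi.sub_apply, Pi.smul_apply, Finset.sum_apply, Smooth.toFun_conjugate, conjFun, smul_eq_mul]
  refine ⟨⟨?_, fun k => ?_, fun n => ?_, fun k => ?_, fun k n => ?_, fun n => ?_⟩, fun z => ?_⟩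
  · rw [hh]
    exact hqH.isWeylSymbol hħ
  · rw [ha]
    exact (hq k).isWeylSymbol hħ
  · rw [hh]
    exact hqH.seriesTerminate_wigner (K t) n
  · rw [ha, ← Smooth.toFun_poly]
    exact (Smooth.finiteOrder_poly (a k)).seriesTerminate_left (smoothWigner ħ (K t))
  · rw [hmoyal, ha']
    exact (hq' k).seriesTerminate_wigner (Λ k (K t)) n
  · rw [hflowP, hflowX]
    exact ⟨Smooth.contDiff _, Smooth.contDiff _⟩
  · have hk (k : κ) := (hq' k).hasKernel_commutator ((hq k).hasKernel_mul hK)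
    have hker := ((hqH.hasKernel_commutator hK).smul (Complex.I / ħ)).add
      ((HasKernel.sum Finset.univ fun k _ => (hk k).add (hk k).dagger).smul (1 / 2))
    -- The time derivative of the kernel is known only as a kernel of the generator; uniqueness
    -- makes it the explicit one.
    have e := hkerK'.kernel_unique hker
    have hW := congrArg (smoothWigner ħ) e
    simp only [map_add, map_smul, map_sum, smoothWigner_adjointKer, hPQ, hPQ'] at hW
    rw [generator_eq_neg_divergence hħ.ne'] at hW
    rw [hflowP, hflowX, phaseDiv_toFun]
    have hW' := congrFun (congrArg Smooth.toFun hW) z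
    rw [map_neg, toFun_smoothWigner, Pi.neg_apply] at hW'
    rw [← hW']
    exact hasDerivWithinAt_wigner ħ hK' z
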